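/- Let $d,m\in\mathbb N_0$. There is a constant $c_{d,m}>0$, depending only on $(d,m)$, such that the following holds. Setting. Let $\mu$ be a probability measure on $\mathbb R^d$ and, for every $t$, let $Q(\cdot\mid z,t)$ be a Markov kernel (in $z$) on $\mathbb R^d$. Let $T,L>0$. For $t\in[0,T]$ put $Y(t)=tX+\sqrt t\,N$ with $X\sim\mu$ and $N\sim\mathsf N(0,\mathrm I)$ independent, and let $P(\cdot\mid y,t)=\mathbb P[X\in\cdot\mid Y(t)=y]$ be the conditional law of $X$ given $Y(t)=y$. Assume: 1. (sub-Gaussian tails) $\int e^{\|x\|^2/L^2}\mu(dx)\le 2$ and $\mathbb E\big[\int e^{\|x\|^2/L^2}Q(dx\mid Y(t),t)\big]\le 2$ for all $t\in[0,T]$; 2. (matched moments) for every $t\in[0,T]$, for almost every $y$ with respect to the law of $Y(t)$, and for all $\alpha\in\mathbb N_0^d$ with $\sum_i\alpha_i\le m$, $\int x^\alpha P(dx\mid y,t)=\int x^\alpha Q(dx\mid y,t)$, where $x^\alpha=\prod_i x_i^{\alpha_i}$. Let $n\in\mathbb N_0$, let $\delta_1,\dots,\delta_n>0$ be step sizes,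 $t_k=\delta_1+\dots+\delta_k$ (so $t_0=0$), and assume $t_{k-1}\le T$ for $k=1,\dots,n$. Let $Y_0=0$ and $Y_k=Y_{k-1}+\delta_kX+\sqrt{\delta_k}\,N_k$, where $X\sim\mu$ is independent of the i.i.d. standard Gaussian vectors $N_1,\dots,N_n$. Let $Z_0=0$ and $Z_k=Z_{k-1}+\delta_k\hat X_k+\sqrt{\delta_k}\,\tilde N_k$, where, conditionally on $(Z_0,\dots,Z_{k-1})$, $\hat X_k$ is drawn from $Q(\cdot\mid Z_{k-1},t_{k-1})$, and $\tilde N_k\sim\mathsf N(0,\mathrm I)$ is independent of $(Z_0,\dots,Z_{k-1},\hat X_k)$. Let $\Delta_n=D\big(\mathsf{Law}(Y_1,\dots,Y_n)\,\|\,\mathsf{Law}(Z_1,\dots,Z_n)\big)$ be the Kullback–Leibler divergence (natural logarithm). Conclusion. Then $$\Delta_n\le c_{d,m}\,L^{2(m+1)}\sum_{k=1}^n\delta_k^{m+1}.$$ In particular, for all $T,L>0$ there is a constant $c_{d,m,T,L}>0$, depending only on $(d,m,T,L)$, such that in the above setting with $n\ge 1$ and uniform steps $\delta_k=T/n$, $k=1,\dots,n$,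 $$\Delta_n\le c_{d,m,T,L}\,n^{-m}.$$ -/

import Mathlib

open MeasureTheory ProbabilityTheory Finset
open scoped ENNReal

universe u v

noncomputable section

/-- The Euclidean space `ℝ^d`. -/
abbrev Vec (d : ℕ) : Type := EuclideanSpace ℝ (Fin d)

/-- The times `t_k = δ_1 + ⋯ + δ_k`, with `t_0 = 0`. -/
def time (δ : ℕ → ℝ) (k : ℕ) : ℝ := ∑ i ∈ Icc 1 k, δ i

/-- The observation `Y(t) = t X + √t N` as a function of the pair `(X, N)`. -/
def obs {d : ℕ} (t : ℝ) (p : Vec d × Vec d) : Vec d := t • p.1 + √t • p.2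

/-- The law of `Y(t) = t X + √t N`, where `X ∼ μ` and `N ∼ N(0, I)` are independent. -/
def obsLaw {d : ℕ} (μ : Measure (Vec d)) (t : ℝ) : Measure (Vec d) :=
  (μ.prod (stdGaussian (Vec d))).map (obs t)

/-- `P(· ∣ y, t)`, the regular conditional law of `X` given `Y(t) = y`. -/
def posteriorKernel {d : ℕ} (μ : Measure (Vec d)) [IsProbabilityMeasure μ] (t : ℝ) :
    Kernel (Vec d) (Vec d) :=
  condDistrib Prod.fst (obs t) (μ.prod (stdGaussian (Vec d)))

/-- Sub-Gaussian tails with parameter `L`, and moments matched up to order `m`, on `[0, T]`. -/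
structure MomentCondition {d : ℕ} (T L : ℝ) (m : ℕ) (μ : Measure (Vec d))
    [IsProbabilityMeasure μ] (Q : ℝ → Kernel (Vec d) (Vec d)) : Prop where
  T_pos : 0 < T
  L_pos : 0 < L
  subGaussian_target : ∫⁻ x, ENNReal.ofReal (Real.exp (‖x‖ ^ 2 / L ^ 2)) ∂μ ≤ 2
  subGaussian_kernel : ∀ t ∈ Set.Icc 0 T,
    ∫⁻ y, ∫⁻ x, ENNReal.ofReal (Real.exp (‖x‖ ^ 2 / L ^ 2)) ∂(Q t y) ∂(obsLaw μ t) ≤ 2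
  moments : ∀ t ∈ Set.Icc 0 T, ∀ᵐ y ∂(obsLaw μ t), ∀ α : Fin d → ℕ, ∑ i, α i ≤ m →
    ∫ x, ∏ i, x i ^ α i ∂(posteriorKernel μ t y) = ∫ x, ∏ i, x i ^ α i ∂(Q t y)

/-- The first `n` steps of the comparison process: `Y_0 = 0` and
`Y_k = Y_{k-1} + δ_k X + √δ_k N_k`, where `X ∼ μ` is independent of the i.i.d. standard
Gaussian vectors `N_1, …, N_n`. -/
structure IsComparisonProcess {d : ℕ} {Ω : Type*} [MeasurableSpace Ω] (P : Measure Ω)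
    (n : ℕ) (δ : ℕ → ℝ) (μ : Measure (Vec d))
    (X : Ω → Vec d) (N Y : ℕ → Ω → Vec d) : Prop where
  law_target : HasLaw X μ P
  law_noise : ∀ k < n, HasLaw (N (k + 1)) (stdGaussian (Vec d)) P
  indep_noise : iIndepFun (fun k : Fin n => N (k + 1)) P
  indep_target : IndepFun X (fun ω (k : Fin n) => N (k + 1) ω) P
  zero : ∀ ω, Y 0 ω = 0
  step : ∀ k < n, ∀ ω, Y (k + 1) ω = Y k ω + δ (k + 1) • X ω + √(δ (k + 1)) • N (k + 1) ω

/-- The kernel `(z_0, …, z_k) ↦ Q(· ∣ z_k, t)`. -/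
def historyKernel {d : ℕ} (κ : Kernel (Vec d) (Vec d)) (k : ℕ) :
    Kernel (Fin (k + 1) → Vec d) (Vec d) :=
  κ.comap (fun z => z (Fin.last k)) (measurable_pi_apply _)

/-- The first `n` steps of the randomized sampler: `Z_0 = 0` and
`Z_k = Z_{k-1} + δ_k X̂_k + √δ_k Ñ_k`, where, given the past `(Z_0, …, Z_{k-1})`, the vector
`X̂_k` is drawn from `Q(· ∣ Z_{k-1}, t_{k-1})`, and `Ñ_k` is a standard Gaussian vector
independent of `(Z_0, …, Z_{k-1}, X̂_k)`. -/
structure IsSampler {d : ℕ} {Ω : Type*} [MeasurableSpace Ω] (P : Measure Ω)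
    (n : ℕ) (δ : ℕ → ℝ) (Q : ℝ → Kernel (Vec d) (Vec d))
    (Xhat N Z : ℕ → Ω → Vec d) : Prop where
  cond_law : ∀ k < n, HasCondDistrib (Xhat (k + 1)) (fun ω (i : Fin (k + 1)) => Z i ω)
    (historyKernel (Q (time δ k)) k) P
  law_noise : ∀ k < n, HasLaw (N (k + 1)) (stdGaussian (Vec d)) P
  indep_noise : ∀ k < n,
    IndepFun (fun ω => ((fun i : Fin (k + 1) => Z i ω), Xhat (k + 1) ω)) (N (k + 1)) P
  zero : ∀ ω, Z 0 ω = 0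
  step : ∀ k < n, ∀ ω,
    Z (k + 1) ω = Z k ω + δ (k + 1) • Xhat (k + 1) ω + √(δ (k + 1)) • N (k + 1) ω

/-- The joint law of `(Y_1, …, Y_n)`. -/
def pathLaw {d : ℕ} {Ω : Type*} [MeasurableSpace Ω] (P : Measure Ω) (n : ℕ)
    (Y : ℕ → Ω → Vec d) : Measure (Fin n → Vec d) :=
  P.map (fun ω i => Y (i + 1) ω)

/-- `Δ_n = D(Law(Y_1, …, Y_n) ‖ Law(Z_1, …, Z_n))`. -/
def pathDivergence {d : ℕ} {Ω Ω' : Type*} [MeasurableSpace Ω] [MeasurableSpace Ω']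
    (P : Measure Ω) (P' : Measure Ω') (n : ℕ) (Y : ℕ → Ω → Vec d) (Z : ℕ → Ω' → Vec d) : ℝ≥0∞ :=
  InformationTheory.klDiv (pathLaw P n Y) (pathLaw P' n Z)

end

/-! ### Divergence: chain rule, densities, and scalar bounds on `klFun`. -/

section

open InformationTheory
open scoped RealInnerProductSpace

/-! The comparison process is itself a sampler, one that draws from the exact posterior. Given the
whole past, the law of `X` depends on the current state only, because the Brownian-bridge part of
the past is independent of `(Y_k, X)`; this is `IsComparisonProcess.hasCondDistrib_path`. Both
processes are therefore Markov chains, and the chain rule bounds the path divergence by a sum of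
one-step divergences averaged over the law of `Y` (`klDiv_historyLaw_le_sum`). Since the average is
under the first argument of the divergence, `Q` is only ever evaluated where its moments and tails
are controlled; nothing is needed along the law of `Z`.

After rescaling, one step compares `P * γ` with `Q * γ`, where `γ` is the standard Gaussian and `P`,
`Q` share their moments up to order `m`. Write `p`, `q` for the densities with respect to `γ` and `s
= √δ L` for the scale of `P` and `Q`.

If `s` is small, center `Q`. Jensen bounds `q` below by a constant, so the divergence is at most a
constant times `∫ (p - q)² dγ`. As `∫ p q dγ = ∬ exp⟪x, z⟫ dP dQ`, matched moments cancel the Taylor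
polynomial of degree `m`, and the remainder has order `s ^ (2 * (m + 1))`
(`klDiv_conv_stdGaussian_le_of_small`). If `s` is large, joint convexity bounds the divergence by
second moments, and a power of `16 s² ≥ 1` supplies the missing order. Together these give
`klDiv_conv_stdGaussian_le` with no restriction on the step size.

That bound is linear in the exponential moments of `P` and `Q`. Linearity is essential: the tail
hypothesis on the kernel holds only on average over `Y(t)`, and the tower property gives the same
average bound for the posterior. -/

theorem klDiv_compProd_right_eq_lintegral {α β : Type*} [MeasurableSpace α] [MeasurableSpace β]
    [MeasurableSpace.CountableOrCountablyGenerated α β] (μ : Measure α) [IsFiniteMeasure μ]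
    (κ η : Kernel α β) [IsMarkovKernel κ] [IsMarkovKernel η] (h : ∀ a, κ a ≪ η a) :
    klDiv (μ ⊗ₘ κ) (μ ⊗ₘ η) = ∫⁻ a, klDiv (κ a) (η a) ∂μ := by
  have hm : Measurable (Function.uncurry (Kernel.rnDeriv κ η)) := Kernel.measurable_rnDeriv κ η
  have hκ : κ = η.withDensity (Kernel.rnDeriv κ η) := by
    ext1 a
    exact (Kernel.withDensity_rnDeriv_eq (h a)).symm
  have hs : IsSFiniteKernel (η.withDensity (Kernel.rnDeriv κ η)) := by
    rw [← hκ]; infer_instance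
  have hjoint : μ ⊗ₘ κ = (μ ⊗ₘ η).withDensity (fun p => Kernel.rnDeriv κ η p.1 p.2) := by
    conv_lhs => rw [hκ]
    exact Measure.compProd_withDensity hm
  have hac : μ ⊗ₘ κ ≪ μ ⊗ₘ η := by
    rw [hjoint]; exact withDensity_absolutelyContinuous _ _
  rw [klDiv_eq_lintegral_klFun_of_ac hac]
  have hr : (μ ⊗ₘ κ).rnDeriv (μ ⊗ₘ η) =ᵐ[μ ⊗ₘ η] fun p => Kernel.rnDeriv κ η p.1 p.2 := by
    rw [hjoint]
    exact Measure.rnDeriv_withDensity _ hm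
  have h1 : ∫⁻ p, ENNReal.ofReal (klFun ((μ ⊗ₘ κ).rnDeriv (μ ⊗ₘ η) p).toReal) ∂(μ ⊗ₘ η) =
      ∫⁻ p, ENNReal.ofReal (klFun (Kernel.rnDeriv κ η p.1 p.2).toReal) ∂(μ ⊗ₘ η) := by
    refine lintegral_congr_ae ?_
    filter_upwards [hr] with p hp
    rw [hp]
  have hm2 : Measurable fun p : α × β =>
      ENNReal.ofReal (klFun (Kernel.rnDeriv κ η p.1 p.2).toReal) :=
    (measurable_klFun.comp hm.ennreal_toReal).ennreal_ofReal
  rw [h1, Measure.lintegral_compProd hm2]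
  refine lintegral_congr fun a => ?_
  rw [klDiv_eq_lintegral_klFun_of_ac (h a)]
  refine lintegral_congr_ae ?_
  filter_upwards [Kernel.rnDeriv_eq_rnDeriv_measure (κ := κ) (η := η) (a := a)] with b hb
  rw [hb]

theorem klDiv_withDensity_withDensity {α : Type*} [MeasurableSpace α] (ν : Measure α)
    [SigmaFinite ν] {p q : α → ℝ≥0∞} (hp : Measurable p) (hq : Measurable q)
    (hq0 : ∀ x, q x ≠ 0) (hqt : ∀ x, q x ≠ ∞)
    [IsFiniteMeasure (ν.withDensity p)] [IsFiniteMeasure (ν.withDensity q)] :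
    klDiv (ν.withDensity p) (ν.withDensity q) =
      ∫⁻ x, q x * ENNReal.ofReal (klFun ((p x).toReal / (q x).toReal)) ∂ν := by
  have hpq : ν.withDensity p = (ν.withDensity q).withDensity (fun x => p x / q x) := by
    have h := withDensity_mul ν hq (hp.div hq)
    rw [show (fun x => p x / q x) = p / q from rfl, ← h]
    congr 1
    ext x
    exact (ENNReal.mul_div_cancel (hq0 x) (hqt x)).symm
  have hac : ν.withDensity p ≪ ν.withDensity q := by
    rw [hpq]; exact withDensity_absolutelyContinuous _ _
  rw [klDiv_eq_lintegral_klFun_of_ac hac]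
  have hr : (ν.withDensity p).rnDeriv (ν.withDensity q) =ᵐ[ν.withDensity q]
      fun x => p x / q x := by
    rw [hpq]
    exact Measure.rnDeriv_withDensity _ (hp.div hq)
  have h1 : ∫⁻ x, ENNReal.ofReal (klFun ((ν.withDensity p).rnDeriv (ν.withDensity q) x).toReal)
      ∂(ν.withDensity q) = ∫⁻ x, ENNReal.ofReal (klFun ((p x).toReal / (q x).toReal))
      ∂(ν.withDensity q) := by
    refine lintegral_congr_ae ?_
    filter_upwards [hr] with x hx
    rw [hx, ENNReal.toReal_div]
  rw [h1, lintegral_withDensity_eq_lintegral_mul _ hq]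
  · rfl
  · exact (measurable_klFun.comp (hp.ennreal_toReal.div hq.ennreal_toReal)).ennreal_ofReal

theorem klFun_le_sq {x : ℝ} (hx : 0 ≤ x) : klFun x ≤ (x - 1) ^ 2 := by
  rw [klFun_apply]
  rcases hx.eq_or_lt with rfl | hx
  · simp
  · nlinarith [Real.log_le_sub_one_of_pos hx]

/-- The left side is the tangent line of the convex function `klFun` at `r`. It serves to prove
joint convexity of the divergence pointwise. -/
theorem log_mul_add_one_sub_le_klFun {x r : ℝ} (hx : 0 ≤ x) (hr : 0 < r) :
    Real.log r * x + 1 - r ≤ klFun x := by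
  rw [klFun_apply]
  rcases hx.eq_or_lt with rfl | hx
  · simp; linarith
  · have h := Real.log_le_sub_one_of_pos (div_pos hr hx)
    rw [Real.log_div hr.ne' hx.ne'] at h
    have := mul_le_mul_of_nonneg_right h hx.le
    field_simp at this
    nlinarith

/-- Data processing applied to the map and to its inverse. -/
theorem klDiv_map_measurableEquiv {α β : Type*} [MeasurableSpace α] [MeasurableSpace β]
    (μ ν : Measure α) [IsFiniteMeasure μ] [IsFiniteMeasure ν] (e : α ≃ᵐ β) :
    klDiv (μ.map e) (ν.map e) = klDiv μ ν := by
  refine le_antisymm (klDiv_map_le _ _ e.measurable) ?_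
  have h := klDiv_map_le (μ.map e) (ν.map e) e.symm.measurable
  simpa using h

theorem ofReal_integral_le_lintegral_ofReal {α : Type*} [MeasurableSpace α] {μ : Measure α}
    {f : α → ℝ} (hf : Integrable f μ) :
    ENNReal.ofReal (∫ x, f x ∂μ) ≤ ∫⁻ x, ENNReal.ofReal (f x) ∂μ := by
  calc ENNReal.ofReal (∫ x, f x ∂μ) ≤ ENNReal.ofReal (∫ x, max (f x) 0 ∂μ) :=
        ENNReal.ofReal_le_ofReal (integral_mono hf hf.pos_part fun x => le_max_left _ _)
    _ = ∫⁻ x, ENNReal.ofReal (max (f x) 0) ∂μ :=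
        ofReal_integral_eq_lintegral_ofReal hf.pos_part (.of_forall fun x => le_max_right _ _)
    _ = _ := by simp [ENNReal.ofReal_max]

/-! ### Gaussian shifts and densities of Gaussian convolutions. -/

section

variable {d : ℕ}

/-- The density at `y` of the unit Gaussian with mean `a`, with respect to the standard Gaussian. -/
noncomputable def shiftDensity (a y : Vec d) : ℝ := Real.exp (⟪a, y⟫ - ‖a‖ ^ 2 / 2)

theorem shiftDensity_pos (a y : Vec d) : 0 < shiftDensity a y := Real.exp_pos _

theorem continuous_shiftDensity : Continuous fun p : Vec d × Vec d => shiftDensity p.1 p.2 := by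
  unfold shiftDensity; fun_prop

theorem measurable_shiftDensity : Measurable fun p : Vec d × Vec d => shiftDensity p.1 p.2 :=
  continuous_shiftDensity.measurable

theorem measurable_ofReal_shiftDensity_left (y : Vec d) :
    Measurable fun x => ENNReal.ofReal (shiftDensity x y) := by
  unfold shiftDensity; fun_prop

theorem measurable_ofReal_shiftDensity_right (x : Vec d) :
    Measurable fun y => ENNReal.ofReal (shiftDensity x y) := by
  unfold shiftDensity; fun_prop

/-- Completing the square gives a bound uniform in the mean `a`, so `convDensity` is a convergent
integral for every probability measure, without moment assumptions. -/
theorem shiftDensity_le (a y : Vec d) : shiftDensity a y ≤ Real.exp (‖y‖ ^ 2 / 2) := by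
  unfold shiftDensity
  gcongr
  have := real_inner_le_norm a y
  nlinarith [sq_nonneg (‖a‖ - ‖y‖)]

/-- The integral factors over coordinates, and each factor is the complex moment generating function
of a real Gaussian at `a i + t i * I`. It provides both the normalization of `shiftDensity` and the
characteristic function of the tilted measure. -/
theorem integral_cexp_stdGaussian (a t : Vec d) :
    ∫ x, (shiftDensity a x : ℂ) * Complex.exp (⟪x, t⟫ * Complex.I) ∂(stdGaussian (Vec d)) =
      Complex.exp (⟪a, t⟫ * Complex.I - ‖t‖ ^ 2 / 2) := by
  rw [← map_pi_eq_stdGaussian, integral_map (by fun_prop)]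
  swap
  · refine Continuous.aestronglyMeasurable ?_
    unfold shiftDensity; fun_prop
  have h1 : ∀ x : Fin d → ℝ, (shiftDensity a (WithLp.toLp 2 x) : ℂ) *
      Complex.exp (⟪(WithLp.toLp 2 x : Vec d), t⟫ * Complex.I) =
      ∏ i, (Complex.exp (-(a i : ℂ) ^ 2 / 2) *
        Complex.exp (((a i : ℂ) + t i * Complex.I) * x i)) := by
    intro x
    simp only [← Complex.exp_add, ← Complex.exp_sum, shiftDensity, Complex.ofReal_exp]
    congr 1
    simp only [EuclideanSpace.real_norm_sq_eq, PiLp.inner_apply]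
    push_cast
    simp only [Finset.sum_mul, Finset.sum_div, ← Finset.sum_sub_distrib, ← Finset.sum_add_distrib]
    refine Finset.sum_congr rfl fun i _ => ?_
    simp
    ring
  simp_rw [h1]
  rw [integral_fintype_prod_eq_prod (f := fun i (x : ℝ) => (Complex.exp (-(a i : ℂ) ^ 2 / 2) *
        Complex.exp (((a i : ℂ) + t i * Complex.I) * x)))]
  have h2 : ∀ i, ∫ x : ℝ, (Complex.exp (-(a i : ℂ) ^ 2 / 2) *
        Complex.exp (((a i : ℂ) + t i * Complex.I) * x)) ∂(gaussianReal 0 1) =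
        Complex.exp (a i * t i * Complex.I - t i ^ 2 / 2) := by
    intro i
    rw [integral_const_mul]
    have := complexMGF_id_gaussianReal (μ := 0) (v := 1) ((a i : ℂ) + t i * Complex.I)
    rw [complexMGF] at this
    simp only [id] at this
    rw [this, ← Complex.exp_add]
    congr 1
    push_cast
    ring_nf
    rw [Complex.I_sq]
    ring
  simp_rw [h2, ← Complex.exp_sum]
  congr 1
  rw [← Complex.ofReal_pow, EuclideanSpace.real_norm_sq_eq, PiLp.inner_apply]
  push_cast
  simp only [Finset.sum_mul, Finset.sum_div, ← Finset.sum_sub_distrib]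
  refine Finset.sum_congr rfl fun i _ => ?_
  simp
  ring

theorem integral_shiftDensity (a : Vec d) :
    ∫ x, shiftDensity a x ∂(stdGaussian (Vec d)) = 1 := by
  have h := integral_cexp_stdGaussian a 0
  simp only [inner_zero_right, Complex.ofReal_zero, zero_mul, Complex.exp_zero, mul_one,
    norm_zero] at h
  rw [integral_complex_ofReal] at h
  simpa using h

theorem integrable_shiftDensity (a : Vec d) :
    Integrable (shiftDensity a) (stdGaussian (Vec d)) := by
  by_contra h
  have := integral_shiftDensity a
  rw [integral_undef h] at this
  exact zero_ne_one this

/-- Cameron–Martin in finite dimension: the two sides have equal characteristic functions. -/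
theorem map_add_const_stdGaussian (a : Vec d) :
    (stdGaussian (Vec d)).map (fun y => a + y) =
      (stdGaussian (Vec d)).withDensity (fun y => ENNReal.ofReal (shiftDensity a y)) := by
  have hm : Measurable (shiftDensity a) := by
    unfold shiftDensity; fun_prop
  have : IsFiniteMeasure ((stdGaussian (Vec d)).withDensity
      (fun y => ENNReal.ofReal (shiftDensity a y))) :=
    isFiniteMeasure_withDensity_ofReal (integrable_shiftDensity a).2
  have : IsProbabilityMeasure ((stdGaussian (Vec d)).map (fun y => a + y)) :=
    Measure.isProbabilityMeasure_map (by fun_prop)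
  refine Measure.ext_of_charFun ?_
  ext t
  rw [charFun_apply, charFun_apply, integral_withDensity_eq_integral_toReal_smul
    hm.ennreal_ofReal (by simp)]
  simp_rw [ENNReal.toReal_ofReal (shiftDensity_pos a _).le, Complex.real_smul]
  rw [integral_cexp_stdGaussian, integral_map (by fun_prop)
    (Continuous.aestronglyMeasurable (by fun_prop))]
  simp_rw [inner_add_left, Complex.ofReal_add, add_mul, Complex.exp_add]
  rw [integral_const_mul, ← charFun_apply, charFun_stdGaussian, ← Complex.exp_add]
  congr 1
  ring

/-- The density with respect to the standard Gaussian of its convolution with `P`. -/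
noncomputable def convDensity (P : Measure (Vec d)) (y : Vec d) : ℝ := ∫ x, shiftDensity x y ∂P

section

variable (P Q : Measure (Vec d)) [IsProbabilityMeasure P] [IsProbabilityMeasure Q]

theorem integrable_shiftDensity_left (y : Vec d) : Integrable (fun x => shiftDensity x y) P := by
  refine Integrable.of_bound (C := Real.exp (‖y‖ ^ 2 / 2)) ?_ (.of_forall fun x => ?_)
  · exact (continuous_shiftDensity.comp (by fun_prop : Continuous fun x : Vec d => (x, y))
      ).aestronglyMeasurable
  · rw [Real.norm_of_nonneg (shiftDensity_pos _ _).le]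
    exact shiftDensity_le x y

theorem convDensity_pos (y : Vec d) : 0 < convDensity P y := by
  rw [convDensity, integral_pos_iff_support_of_nonneg (fun x => (shiftDensity_pos x y).le)
    (integrable_shiftDensity_left P y)]
  have : (Function.support fun x => shiftDensity x y) = Set.univ :=
    Set.eq_univ_of_forall fun x => (shiftDensity_pos x y).ne'
  simp [this]

theorem measurable_convDensity : Measurable (convDensity P) := by
  have h : StronglyMeasurable fun p : Vec d × Vec d => shiftDensity p.2 p.1 :=
    (continuous_shiftDensity.comp continuous_swap).stronglyMeasurable
  exact h.integral_prod_right.measurable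

theorem lintegral_shiftDensity_left (y : Vec d) :
    ∫⁻ x, ENNReal.ofReal (shiftDensity x y) ∂P = ENNReal.ofReal (convDensity P y) :=
  (ofReal_integral_eq_lintegral_ofReal (integrable_shiftDensity_left P y)
    (.of_forall fun x => (shiftDensity_pos x y).le)).symm

theorem conv_stdGaussian_eq_withDensity :
    P.conv (stdGaussian (Vec d)) =
      (stdGaussian (Vec d)).withDensity (fun y => ENNReal.ofReal (convDensity P y)) := by
  have hs : Measurable fun p : Vec d × Vec d => ENNReal.ofReal (shiftDensity p.1 p.2) :=
    measurable_shiftDensity.ennreal_ofReal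
  refine Measure.ext_of_lintegral _ fun g hg => ?_
  rw [Measure.lintegral_conv hg, lintegral_withDensity_eq_lintegral_mul _
    (measurable_convDensity P).ennreal_ofReal hg]
  have h1 : ∀ x, ∫⁻ y, g (x + y) ∂(stdGaussian (Vec d)) =
      ∫⁻ y, ENNReal.ofReal (shiftDensity x y) * g y ∂(stdGaussian (Vec d)) := by
    intro x
    have h2 : ∫⁻ y, g (x + y) ∂(stdGaussian (Vec d)) =
        ∫⁻ z, g z ∂((stdGaussian (Vec d)).map (fun y => x + y)) :=
      (lintegral_map hg (measurable_const_add x)).symm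
    rw [h2, map_add_const_stdGaussian]
    exact lintegral_withDensity_eq_lintegral_mul _ (measurable_ofReal_shiftDensity_right x) hg
  simp_rw [h1]
  rw [lintegral_lintegral_swap]
  · refine lintegral_congr fun y => ?_
    have h3 := lintegral_mul_const (μ := P) (g y) (measurable_ofReal_shiftDensity_left y)
    rw [h3, lintegral_shiftDensity_left]
    rfl
  · exact (hs.mul (hg.comp measurable_snd)).aemeasurable

instance : IsProbabilityMeasure (P.conv (stdGaussian (Vec d))) := by
  unfold Measure.conv
  exact Measure.isProbabilityMeasure_map (by fun_prop)

theorem klDiv_conv_stdGaussian :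
    klDiv (P.conv (stdGaussian (Vec d))) (Q.conv (stdGaussian (Vec d))) =
      ∫⁻ y, ENNReal.ofReal (convDensity Q y * klFun (convDensity P y / convDensity Q y))
        ∂(stdGaussian (Vec d)) := by
  have hP := conv_stdGaussian_eq_withDensity P
  have hQ := conv_stdGaussian_eq_withDensity Q
  have : IsFiniteMeasure ((stdGaussian (Vec d)).withDensity
      (fun y => ENNReal.ofReal (convDensity P y))) := by rw [← hP]; infer_instance
  have : IsFiniteMeasure ((stdGaussian (Vec d)).withDensity
      (fun y => ENNReal.ofReal (convDensity Q y))) := by rw [← hQ]; infer_instance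
  rw [hP, hQ, klDiv_withDensity_withDensity _ (measurable_convDensity P).ennreal_ofReal
    (measurable_convDensity Q).ennreal_ofReal]
  · refine lintegral_congr fun y => ?_
    rw [ENNReal.toReal_ofReal (convDensity_pos P y).le,
      ENNReal.toReal_ofReal (convDensity_pos Q y).le, ENNReal.ofReal_mul (convDensity_pos Q y).le]
  · exact fun x => (ENNReal.ofReal_pos.2 (convDensity_pos Q x)).ne'
  · simp

theorem conv_stdGaussian_absolutelyContinuous :
    P.conv (stdGaussian (Vec d)) ≪ Q.conv (stdGaussian (Vec d)) := by
  rw [conv_stdGaussian_eq_withDensity P, conv_stdGaussian_eq_withDensity Q]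
  refine (withDensity_absolutelyContinuous _ _).trans
    (withDensity_absolutelyContinuous' (measurable_convDensity Q).ennreal_ofReal.aemeasurable
      (.of_forall fun x => (ENNReal.ofReal_pos.2 (convDensity_pos Q x)).ne'))

end

end

/-! ### The large-scale bound: convexity and second moments. -/

section

variable {d : ℕ}

theorem shiftDensity_mul_shiftDensity (a b y : Vec d) :
    shiftDensity a y * shiftDensity b y = Real.exp ⟪a, b⟫ * shiftDensity (a + b) y := by
  simp only [shiftDensity, ← Real.exp_add]
  congr 1
  rw [inner_add_left, norm_add_sq_real]
  ring

/-- In `L²(γ)` the shift densities have Gram kernel `exp⟪a, b⟫`. This is what allows squared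
distances between convolution densities to be expanded in moments. -/
theorem integral_shiftDensity_mul (a b : Vec d) :
    ∫ y, shiftDensity a y * shiftDensity b y ∂(stdGaussian (Vec d)) = Real.exp ⟪a, b⟫ := by
  simp_rw [shiftDensity_mul_shiftDensity, integral_const_mul, integral_shiftDensity, mul_one]

theorem integrable_shiftDensity_mul (a b : Vec d) :
    Integrable (fun y => shiftDensity a y * shiftDensity b y) (stdGaussian (Vec d)) := by
  simp_rw [shiftDensity_mul_shiftDensity]
  exact (integrable_shiftDensity _).const_mul _

theorem integrable_inner_mul_shiftDensity (v a : Vec d) :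
    Integrable (fun y => shiftDensity a y * ⟪v, y⟫) (stdGaussian (Vec d)) := by
  have h : Integrable (fun y : Vec d => ⟪v, y⟫) ((stdGaussian (Vec d)).map (fun y => a + y)) := by
    rw [integrable_map_measure (Continuous.aestronglyMeasurable (by fun_prop)) (by fun_prop)]
    have : Integrable (fun y : Vec d => a + y) (stdGaussian (Vec d)) :=
      (integrable_const a).add IsGaussian.integrable_fun_id
    exact this.const_inner v
  rw [map_add_const_stdGaussian, integrable_withDensity_iff_integrable_smul'
    (measurable_ofReal_shiftDensity_right a) (by simp)] at h
  simpa [ENNReal.toReal_ofReal (shiftDensity_pos a _).le] using h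

theorem integral_inner_mul_shiftDensity (v a : Vec d) :
    ∫ y, shiftDensity a y * ⟪v, y⟫ ∂(stdGaussian (Vec d)) = ⟪v, a⟫ := by
  have h1 : ∫ y, ⟪v, y⟫ ∂((stdGaussian (Vec d)).map (fun y => a + y)) = ⟪v, a⟫ := by
    rw [integral_map (by fun_prop) (Continuous.aestronglyMeasurable (by fun_prop))]
    have : Integrable (fun y : Vec d => a + y) (stdGaussian (Vec d)) :=
      (integrable_const a).add IsGaussian.integrable_fun_id
    rw [integral_inner this, integral_add (integrable_const a) IsGaussian.integrable_fun_id]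
    have h0 : ∫ y : Vec d, y ∂(stdGaussian (Vec d)) = 0 := integral_id_stdGaussian
    simp [h0]
  rw [map_add_const_stdGaussian, integral_withDensity_eq_integral_toReal_smul
    (measurable_ofReal_shiftDensity_right a) (by simp)] at h1
  simpa [ENNReal.toReal_ofReal (shiftDensity_pos a _).le] using h1

theorem shiftDensity_mul_klFun (a b y : Vec d) :
    shiftDensity b y * klFun (shiftDensity a y / shiftDensity b y) =
      shiftDensity a y * ⟪a - b, y⟫ + (‖b‖ ^ 2 / 2 - ‖a‖ ^ 2 / 2) * shiftDensity a y +
        shiftDensity b y - shiftDensity a y := by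
  have hb := (shiftDensity_pos b y).ne'
  have hl : Real.log (shiftDensity a y / shiftDensity b y) =
      ⟪a - b, y⟫ + (‖b‖ ^ 2 / 2 - ‖a‖ ^ 2 / 2) := by
    rw [Real.log_div (shiftDensity_pos a y).ne' hb, shiftDensity, shiftDensity, Real.log_exp,
      Real.log_exp, inner_sub_left]
    ring
  rw [klFun_apply, hl]
  field_simp

/-- This is the divergence between unit Gaussians with means `a` and `b`. The log-ratio is affine in
`y`, so only the mean of the tilted Gaussian enters. -/
theorem lintegral_shiftDensity_mul_klFun (a b : Vec d) :
    ∫⁻ y, ENNReal.ofReal (shiftDensity b y * klFun (shiftDensity a y / shiftDensity b y))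
      ∂(stdGaussian (Vec d)) = ENNReal.ofReal (‖a - b‖ ^ 2 / 2) := by
  have hnn : ∀ y, 0 ≤ shiftDensity b y * klFun (shiftDensity a y / shiftDensity b y) := fun y =>
    mul_nonneg (shiftDensity_pos b y).le
      (klFun_nonneg (div_pos (shiftDensity_pos a y) (shiftDensity_pos b y)).le)
  have i1 := integrable_inner_mul_shiftDensity (a - b) a
  have i2 := (integrable_shiftDensity a).const_mul (‖b‖ ^ 2 / 2 - ‖a‖ ^ 2 / 2)
  have i3 := integrable_shiftDensity b
  have i4 := integrable_shiftDensity a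
  have i12 : Integrable (fun y => shiftDensity a y * ⟪a - b, y⟫ +
      (‖b‖ ^ 2 / 2 - ‖a‖ ^ 2 / 2) * shiftDensity a y) (stdGaussian (Vec d)) := i1.add i2
  have i123 : Integrable (fun y => shiftDensity a y * ⟪a - b, y⟫ +
      (‖b‖ ^ 2 / 2 - ‖a‖ ^ 2 / 2) * shiftDensity a y + shiftDensity b y)
      (stdGaussian (Vec d)) := i12.add i3
  rw [← ofReal_integral_eq_lintegral_ofReal _ (.of_forall hnn)]
  · congr 1
    simp_rw [shiftDensity_mul_klFun]
    rw [integral_sub i123 i4, integral_add i12 i3, integral_add i1 i2,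
      integral_inner_mul_shiftDensity, integral_const_mul, integral_shiftDensity,
      integral_shiftDensity, norm_sub_sq_real, inner_sub_left, real_inner_self_eq_norm_sq,
      real_inner_comm]
    ring
  · simp_rw [shiftDensity_mul_klFun]
    exact i123.sub i4

section

variable (P Q : Measure (Vec d)) [IsProbabilityMeasure P] [IsProbabilityMeasure Q]

/-- Jensen for the jointly convex function `(p, q) ↦ q * klFun (p / q)` under the product coupling,
through the tangent line at the ratio `r` of the averages. -/
theorem ofReal_convDensity_mul_klFun_le (y : Vec d) :
    ENNReal.ofReal (convDensity Q y * klFun (convDensity P y / convDensity Q y)) ≤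
      ∫⁻ z, ENNReal.ofReal
        (shiftDensity z.2 y * klFun (shiftDensity z.1 y / shiftDensity z.2 y)) ∂(P.prod Q) := by
  set r := convDensity P y / convDensity Q y with hr
  have hq := convDensity_pos Q y
  have hr0 : 0 < r := div_pos (convDensity_pos P y) hq
  have iP := integrable_shiftDensity_left P y
  have iQ := integrable_shiftDensity_left Q y
  have i1 : Integrable (fun z : Vec d × Vec d => Real.log r * shiftDensity z.1 y) (P.prod Q) :=
    (iP.comp_fst Q).const_mul _
  have i2 : Integrable (fun z : Vec d × Vec d => (1 - r) * shiftDensity z.2 y) (P.prod Q) :=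
    (iQ.comp_snd P).const_mul _
  have h1 : convDensity Q y * klFun r = ∫ z : Vec d × Vec d,
      (Real.log r * shiftDensity z.1 y + (1 - r) * shiftDensity z.2 y) ∂(P.prod Q) := by
    rw [integral_add i1 i2, integral_const_mul, integral_const_mul,
      integral_fun_fst (fun x => shiftDensity x y), integral_fun_snd (fun x => shiftDensity x y)]
    simp only [probReal_univ, one_smul]
    change _ = Real.log r * convDensity P y + (1 - r) * convDensity Q y
    have : convDensity P y = r * convDensity Q y := by rw [hr]; field_simp
    rw [this, klFun_apply]
    ring
  rw [h1]
  refine (ofReal_integral_le_lintegral_ofReal (i1.add i2)).trans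
    (lintegral_mono fun z => ENNReal.ofReal_le_ofReal ?_)
  have h2 := log_mul_add_one_sub_le_klFun
    (div_pos (shiftDensity_pos z.1 y) (shiftDensity_pos z.2 y)).le hr0
  have h3 := mul_le_mul_of_nonneg_left h2 (shiftDensity_pos z.2 y).le
  refine le_trans (le_of_eq ?_) h3
  have := (shiftDensity_pos z.2 y).ne'
  simp only [Pi.add_apply]
  field_simp
  ring

theorem klDiv_conv_stdGaussian_le_lintegral_sq :
    klDiv (P.conv (stdGaussian (Vec d))) (Q.conv (stdGaussian (Vec d))) ≤
      ∫⁻ x, ENNReal.ofReal (‖x‖ ^ 2) ∂P + ∫⁻ x, ENNReal.ofReal (‖x‖ ^ 2) ∂Q := by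
  rw [klDiv_conv_stdGaussian]
  refine (lintegral_mono (ofReal_convDensity_mul_klFun_le P Q)).trans ?_
  rw [lintegral_lintegral_swap]
  · simp_rw [lintegral_shiftDensity_mul_klFun]
    calc ∫⁻ z : Vec d × Vec d, ENNReal.ofReal (‖z.1 - z.2‖ ^ 2 / 2) ∂(P.prod Q)
        ≤ ∫⁻ z : Vec d × Vec d, (ENNReal.ofReal (‖z.1‖ ^ 2) + ENNReal.ofReal (‖z.2‖ ^ 2))
          ∂(P.prod Q) := by
          refine lintegral_mono fun z => ?_
          rw [← ENNReal.ofReal_add (by positivity) (by positivity)]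
          refine ENNReal.ofReal_le_ofReal ?_
          have := norm_sub_le z.1 z.2
          nlinarith [sq_nonneg (‖z.1‖ - ‖z.2‖), norm_nonneg (z.1 - z.2)]
      _ = _ := by
          rw [lintegral_add_left (by fun_prop), lintegral_prod _ (by fun_prop),
            lintegral_prod _ (by fun_prop)]
          simp
  · refine Measurable.aemeasurable ?_
    have hc1 : Continuous fun p : Vec d × (Vec d × Vec d) => shiftDensity p.2.1 p.1 := by
      unfold shiftDensity; fun_prop
    have hc2 : Continuous fun p : Vec d × (Vec d × Vec d) => shiftDensity p.2.2 p.1 := by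
      unfold shiftDensity; fun_prop
    exact (hc2.measurable.mul
      (measurable_klFun.comp (hc1.measurable.div hc2.measurable))).ennreal_ofReal

end

end

/-! ### The moment-matching bound: Taylor expansion of the Gaussian kernel. -/

section

variable {d : ℕ}

/-- Two measures have the same directional moments up to order `m`. -/
def SameMoments (m : ℕ) (P Q : Measure (Vec d)) : Prop :=
  ∀ v : Vec d, ∀ k ≤ m, ∫ x, ⟪x, v⟫ ^ k ∂P = ∫ x, ⟪x, v⟫ ^ k ∂Q

/-- Passing to `1 + (u ^ 2) ^ k` covers both parities of `k` with a single term of the exponential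
series. -/
theorem pow_le_mul_exp (k : ℕ) {c u : ℝ} (hc : 0 < c) (hu : 0 ≤ u) :
    u ^ k ≤ (1 + k.factorial * c ^ k) * Real.exp (u ^ 2 / c) := by
  have h1 : u ^ k ≤ 1 + (u ^ 2) ^ k := by
    rcases le_total u 1 with h | h
    · have := pow_le_one₀ hu h (n := k)
      have := pow_nonneg (sq_nonneg u) k
      linarith
    · have h2 : u ≤ u ^ 2 := by nlinarith
      have := pow_le_pow_left₀ hu h2 k
      linarith
  have h2 : (u ^ 2) ^ k ≤ k.factorial * c ^ k * Real.exp (u ^ 2 / c) := by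
    have := Real.pow_div_factorial_le_exp (u ^ 2 / c) (by positivity) k
    rw [div_pow, div_div, div_le_iff₀ (by positivity)] at this
    linarith
  have h3 : 1 ≤ Real.exp (u ^ 2 / c) := Real.one_le_exp (by positivity)
  nlinarith

theorem integrable_norm_pow_of_exp {P : Measure (Vec d)} {c : ℝ} (hc : 0 < c)
    (hP : Integrable (fun x => Real.exp (‖x‖ ^ 2 / c)) P) (k : ℕ) :
    Integrable (fun x => ‖x‖ ^ k) P := by
  refine (hP.const_mul (1 + k.factorial * c ^ k)).mono'
    (Continuous.aestronglyMeasurable (by fun_prop)) (.of_forall fun x => ?_)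
  rw [Real.norm_of_nonneg (by positivity)]
  exact pow_le_mul_exp k hc (norm_nonneg x)

theorem Real.abs_exp_sub_sum_le (x : ℝ) (n : ℕ) :
    |Real.exp x - ∑ k ∈ range n, x ^ k / k.factorial| ≤ |x| ^ n * Real.exp |x| := by
  have h := Complex.norm_exp_sub_sum_le_norm_mul_exp (x : ℂ) n
  rw [Complex.norm_real, Real.norm_eq_abs] at h
  refine le_trans (le_of_eq ?_) h
  rw [← Real.norm_eq_abs, ← Complex.norm_real]
  push_cast
  rfl

/-- The weight that controls Taylor remainders of the Gaussian kernel. -/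
noncomputable def remainderWeight (m : ℕ) (x : Vec d) : ℝ := ‖x‖ ^ (m + 1) * Real.exp (‖x‖ ^ 2 / 2)

theorem remainderWeight_nonneg (m : ℕ) (x : Vec d) : 0 ≤ remainderWeight m x := by
  unfold remainderWeight; positivity

/-- Splitting `|⟪x, z⟫|` as `‖x‖² / 2 + ‖z‖² / 2` in the exponent makes the bound a product, so its
integral over `P.prod Q` factors. -/
theorem abs_exp_inner_sub_sum_le (m : ℕ) (x z : Vec d) :
    |Real.exp ⟪x, z⟫ - ∑ k ∈ range (m + 1), ⟪x, z⟫ ^ k / k.factorial| ≤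
      remainderWeight m x * remainderWeight m z := by
  refine (Real.abs_exp_sub_sum_le _ _).trans ?_
  have h := abs_real_inner_le_norm x z
  have h2 : |⟪x, z⟫| ≤ ‖x‖ ^ 2 / 2 + ‖z‖ ^ 2 / 2 := by nlinarith [sq_nonneg (‖x‖ - ‖z‖)]
  calc |⟪x, z⟫| ^ (m + 1) * Real.exp |⟪x, z⟫|
      ≤ (‖x‖ * ‖z‖) ^ (m + 1) * Real.exp (‖x‖ ^ 2 / 2 + ‖z‖ ^ 2 / 2) := by gcongr
    _ = _ := by rw [Real.exp_add, mul_pow, remainderWeight, remainderWeight]; ring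

theorem integrable_remainderWeight {P : Measure (Vec d)}
    (hP : Integrable (fun x => Real.exp (‖x‖ ^ 2)) P) (m : ℕ) :
    Integrable (remainderWeight m) P := by
  refine (hP.const_mul (1 + (m + 1).factorial * 2 ^ (m + 1))).mono'
    (Continuous.aestronglyMeasurable (by unfold remainderWeight; fun_prop))
    (.of_forall fun x => ?_)
  rw [Real.norm_of_nonneg (remainderWeight_nonneg m x)]
  have h := pow_le_mul_exp (m + 1) two_pos (norm_nonneg x)
  calc remainderWeight m x
      ≤ ((1 + (m + 1).factorial * 2 ^ (m + 1)) * Real.exp (‖x‖ ^ 2 / 2)) *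
        Real.exp (‖x‖ ^ 2 / 2) := by
        unfold remainderWeight; gcongr
    _ = _ := by rw [mul_assoc, ← Real.exp_add, add_halves]

theorem integrable_exp_inner (P Q : Measure (Vec d)) [SFinite Q]
    (hP : Integrable (fun x => Real.exp (‖x‖ ^ 2)) P)
    (hQ : Integrable (fun x => Real.exp (‖x‖ ^ 2)) Q) :
    Integrable (fun z : Vec d × Vec d => Real.exp ⟪z.1, z.2⟫) (P.prod Q) := by
  refine (hP.mul_prod hQ).mono' (Continuous.aestronglyMeasurable (by fun_prop))
    (.of_forall fun z => ?_)
  rw [Real.norm_of_nonneg (Real.exp_pos _).le, ← Real.exp_add]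
  have := real_inner_le_norm z.1 z.2
  gcongr
  nlinarith [sq_nonneg (‖z.1‖ - ‖z.2‖), sq_nonneg (‖z.1‖), sq_nonneg (‖z.2‖)]

theorem integrable_inner_pow_prod (P Q : Measure (Vec d)) [SFinite Q]
    (hP : Integrable (fun x => Real.exp (‖x‖ ^ 2)) P)
    (hQ : Integrable (fun x => Real.exp (‖x‖ ^ 2)) Q) (k : ℕ) :
    Integrable (fun z : Vec d × Vec d => ⟪z.1, z.2⟫ ^ k) (P.prod Q) := by
  have hP' := integrable_norm_pow_of_exp one_pos (P := P) (by simpa using hP) k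
  have hQ' := integrable_norm_pow_of_exp one_pos (P := Q) (by simpa using hQ) k
  refine (hP'.mul_prod hQ').mono' (Continuous.aestronglyMeasurable (by fun_prop))
    (.of_forall fun z => ?_)
  rw [norm_pow, ← mul_pow]
  exact pow_le_pow_left₀ (norm_nonneg _) (norm_inner_le_norm _ _) k

theorem integrable_shiftDensity_mul_prod (P Q : Measure (Vec d)) [SFinite Q]
    [SFinite P] (hP : Integrable (fun x => Real.exp (‖x‖ ^ 2)) P)
    (hQ : Integrable (fun x => Real.exp (‖x‖ ^ 2)) Q) :
    Integrable (fun w : (Vec d × Vec d) × Vec d => shiftDensity w.1.1 w.2 * shiftDensity w.1.2 w.2)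
      ((P.prod Q).prod (stdGaussian (Vec d))) := by
  rw [integrable_prod_iff]
  · refine ⟨.of_forall fun z => integrable_shiftDensity_mul z.1 z.2, ?_⟩
    have h : ∀ z : Vec d × Vec d, ∫ y, ‖shiftDensity z.1 y * shiftDensity z.2 y‖
        ∂(stdGaussian (Vec d)) = Real.exp ⟪z.1, z.2⟫ := by
      intro z
      rw [← integral_shiftDensity_mul]
      refine integral_congr_ae (.of_forall fun y => ?_)
      exact Real.norm_of_nonneg (mul_pos (shiftDensity_pos _ _) (shiftDensity_pos _ _)).le
    simp_rw [h]
    exact integrable_exp_inner P Q hP hQ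
  · refine Continuous.aestronglyMeasurable ?_
    unfold shiftDensity; fun_prop

theorem integrable_taylor (P Q : Measure (Vec d)) [SFinite Q] (m : ℕ)
    (hP : Integrable (fun x => Real.exp (‖x‖ ^ 2)) P)
    (hQ : Integrable (fun x => Real.exp (‖x‖ ^ 2)) Q) :
    Integrable (fun z : Vec d × Vec d => ∑ k ∈ range (m + 1), ⟪z.1, z.2⟫ ^ k / (k.factorial : ℝ))
      (P.prod Q) :=
  integrable_finsetSum _ fun k _ => (integrable_inner_pow_prod P Q hP hQ k).div_const _

section

variable (P Q : Measure (Vec d)) [IsProbabilityMeasure P] [IsProbabilityMeasure Q]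

theorem integral_prod_shiftDensity (y : Vec d) :
    ∫ z : Vec d × Vec d, shiftDensity z.1 y * shiftDensity z.2 y ∂(P.prod Q) =
      convDensity P y * convDensity Q y :=
  integral_prod_mul (fun x => shiftDensity x y) fun x => shiftDensity x y

theorem integrable_convDensity_mul (hP : Integrable (fun x => Real.exp (‖x‖ ^ 2)) P)
    (hQ : Integrable (fun x => Real.exp (‖x‖ ^ 2)) Q) :
    Integrable (fun y => convDensity P y * convDensity Q y) (stdGaussian (Vec d)) := by
  have h := (integrable_shiftDensity_mul_prod P Q hP hQ).integral_prod_right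
  simpa only [integral_prod_shiftDensity] using h

theorem integral_convDensity_mul (hP : Integrable (fun x => Real.exp (‖x‖ ^ 2)) P)
    (hQ : Integrable (fun x => Real.exp (‖x‖ ^ 2)) Q) :
    ∫ y, convDensity P y * convDensity Q y ∂(stdGaussian (Vec d)) =
      ∫ z : Vec d × Vec d, Real.exp ⟪z.1, z.2⟫ ∂(P.prod Q) := by
  simp_rw [← integral_prod_shiftDensity]
  rw [← integral_integral_swap (f := fun (z : Vec d × Vec d) (y : Vec d) =>
    shiftDensity z.1 y * shiftDensity z.2 y) (integrable_shiftDensity_mul_prod P Q hP hQ)]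
  simp_rw [integral_shiftDensity_mul]

/-- The pairing of `P` and `Q` against the Taylor polynomial of the Gaussian kernel. -/
noncomputable def taylorPairing (m : ℕ) (P Q : Measure (Vec d)) : ℝ :=
  ∫ z : Vec d × Vec d, ∑ k ∈ range (m + 1), ⟪z.1, z.2⟫ ^ k / k.factorial ∂(P.prod Q)

/-- With the second variable held fixed, integrating out the first turns each Taylor term into a
directional moment of order at most `m`. -/
theorem taylorPairing_congr_left {m : ℕ} (R : Measure (Vec d)) [IsProbabilityMeasure R]
    (h : SameMoments m P Q)
    (hP : Integrable (fun x => Real.exp (‖x‖ ^ 2)) P)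
    (hQ : Integrable (fun x => Real.exp (‖x‖ ^ 2)) Q)
    (hR : Integrable (fun x => Real.exp (‖x‖ ^ 2)) R) :
    taylorPairing m P R = taylorPairing m Q R := by
  unfold taylorPairing
  rw [integral_finsetSum _ fun k _ => (integrable_inner_pow_prod P R hP hR k).div_const _,
    integral_finsetSum _ fun k _ => (integrable_inner_pow_prod Q R hQ hR k).div_const _]
  refine sum_congr rfl fun k hk => ?_
  rw [integral_div, integral_div, integral_prod_symm _ (integrable_inner_pow_prod P R hP hR k),
    integral_prod_symm _ (integrable_inner_pow_prod Q R hQ hR k)]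
  congr 1
  exact integral_congr_ae (.of_forall fun v => h v k (Nat.lt_succ_iff.1 (mem_range.1 hk)))

theorem taylorPairing_comm (m : ℕ) : taylorPairing m P Q = taylorPairing m Q P := by
  unfold taylorPairing
  rw [← integral_prod_swap]
  simp_rw [Prod.fst_swap, Prod.snd_swap, real_inner_comm]

theorem abs_integral_convDensity_mul_sub_le (m : ℕ)
    (hP : Integrable (fun x => Real.exp (‖x‖ ^ 2)) P)
    (hQ : Integrable (fun x => Real.exp (‖x‖ ^ 2)) Q) :
    |∫ y, convDensity P y * convDensity Q y ∂(stdGaussian (Vec d)) - taylorPairing m P Q| ≤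
      (∫ x, remainderWeight m x ∂P) * ∫ x, remainderWeight m x ∂Q := by
  rw [integral_convDensity_mul P Q hP hQ, taylorPairing,
    ← integral_sub (integrable_exp_inner P Q hP hQ) (integrable_taylor P Q m hP hQ),
    ← integral_prod_mul]
  have hb := norm_integral_le_of_norm_le (μ := P.prod Q)
    (f := fun z : Vec d × Vec d => Real.exp ⟪z.1, z.2⟫ -
      ∑ k ∈ range (m + 1), ⟪z.1, z.2⟫ ^ k / (k.factorial : ℝ))
    ((integrable_remainderWeight hP m).mul_prod (integrable_remainderWeight hQ m))
    (.of_forall fun z => abs_exp_inner_sub_sum_le m z.1 z.2)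
  exact hb

theorem integrable_sq_convDensity_sub (hP : Integrable (fun x => Real.exp (‖x‖ ^ 2)) P)
    (hQ : Integrable (fun x => Real.exp (‖x‖ ^ 2)) Q) :
    Integrable (fun y => (convDensity P y - convDensity Q y) ^ 2) (stdGaussian (Vec d)) := by
  have h := ((integrable_convDensity_mul P P hP hP).sub
    ((integrable_convDensity_mul P Q hP hQ).const_mul 2)).add
    (integrable_convDensity_mul Q Q hQ hQ)
  refine h.congr (.of_forall fun y => ?_)
  simp only [Pi.add_apply, Pi.sub_apply]
  ring

theorem integral_sq_convDensity_sub_le {m : ℕ} (h : SameMoments m P Q)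
    (hP : Integrable (fun x => Real.exp (‖x‖ ^ 2)) P)
    (hQ : Integrable (fun x => Real.exp (‖x‖ ^ 2)) Q) :
    ∫ y, (convDensity P y - convDensity Q y) ^ 2 ∂(stdGaussian (Vec d)) ≤
      (∫ x, remainderWeight m x ∂P + ∫ x, remainderWeight m x ∂Q) ^ 2 := by
  have iPP := integrable_convDensity_mul P P hP hP
  have iPQ := (integrable_convDensity_mul P Q hP hQ).const_mul 2
  have iQQ := integrable_convDensity_mul Q Q hQ hQ
  have iS : Integrable (fun y => convDensity P y * convDensity P y -
      2 * (convDensity P y * convDensity Q y)) (stdGaussian (Vec d)) := iPP.sub iPQ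
  have h1 : ∫ y, (convDensity P y - convDensity Q y) ^ 2 ∂(stdGaussian (Vec d)) =
      ∫ y, convDensity P y * convDensity P y ∂(stdGaussian (Vec d)) -
      2 * ∫ y, convDensity P y * convDensity Q y ∂(stdGaussian (Vec d)) +
      ∫ y, convDensity Q y * convDensity Q y ∂(stdGaussian (Vec d)) := by
    rw [← integral_const_mul, ← integral_sub iPP iPQ, ← integral_add iS iQQ]
    refine integral_congr_ae (.of_forall fun y => ?_)
    ring
  -- The pairings for `PP`, `PQ` and `QQ` all agree, so they cancel in `PP - 2 PQ + QQ`. The three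
  -- remainder bounds add up to the square of the sum of the two weights.
  have e1 := taylorPairing_congr_left P Q P h hP hQ hP
  have e2 := taylorPairing_congr_left P Q Q h hP hQ hQ
  have e3 := taylorPairing_comm Q P m
  have b1 := abs_le.1 (abs_integral_convDensity_mul_sub_le P P m hP hP)
  have b2 := abs_le.1 (abs_integral_convDensity_mul_sub_le P Q m hP hQ)
  have b3 := abs_le.1 (abs_integral_convDensity_mul_sub_le Q Q m hQ hQ)
  rw [h1]
  nlinarith

/-- Jensen for the exponential: centering removes the term linear in `y`, which makes the lower
bound uniform in `y`. -/
theorem exp_neg_le_convDensity (hQ : Integrable (fun x => Real.exp (‖x‖ ^ 2)) Q)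
    (h0 : ∫ x, x ∂Q = 0) (y : Vec d) :
    Real.exp (-(∫ x, ‖x‖ ^ 2 ∂Q) / 2) ≤ convDensity Q y := by
  have hQ' : Integrable (fun x => Real.exp (‖x‖ ^ 2 / 1)) Q := by simpa using hQ
  have h2 := integrable_norm_pow_of_exp one_pos hQ' 2
  have h1 : Integrable (fun x : Vec d => x) Q := by
    have := integrable_norm_pow_of_exp one_pos hQ' 1
    simp only [pow_one] at this
    exact (integrable_norm_iff (by fun_prop)).1 this
  have h3 : Integrable (fun x : Vec d => ⟪x, y⟫ - ‖x‖ ^ 2 / 2) Q :=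
    (h1.inner_const y).sub (h2.div_const 2)
  have h4 : ∫ x : Vec d, (⟪x, y⟫ - ‖x‖ ^ 2 / 2) ∂Q = -(∫ x, ‖x‖ ^ 2 ∂Q) / 2 := by
    rw [integral_sub (h1.inner_const y) (h2.div_const 2), integral_div]
    simp_rw [real_inner_comm y]
    rw [integral_inner h1, h0, inner_zero_right]
    ring
  rw [← h4]
  exact convexOn_exp.map_integral_le Real.continuous_exp.continuousOn isClosed_univ
    (.of_forall fun _ => Set.mem_univ _) h3 (integrable_shiftDensity_left Q y)

/-- A chi-square bound: `klFun_le_sq` leaves `(p - q)² / q`, and the uniform lower bound on `q`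
removes the denominator. -/
theorem klDiv_conv_stdGaussian_le_of_centered {m : ℕ} (h : SameMoments m P Q)
    (hP : Integrable (fun x => Real.exp (‖x‖ ^ 2)) P)
    (hQ : Integrable (fun x => Real.exp (‖x‖ ^ 2)) Q) (h0 : ∫ x, x ∂Q = 0) :
    klDiv (P.conv (stdGaussian (Vec d))) (Q.conv (stdGaussian (Vec d))) ≤
      ENNReal.ofReal (Real.exp ((∫ x, ‖x‖ ^ 2 ∂Q) / 2) *
        (∫ x, remainderWeight m x ∂P + ∫ x, remainderWeight m x ∂Q) ^ 2) := by
  set V := ∫ x, ‖x‖ ^ 2 ∂Q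
  have hi := (integrable_sq_convDensity_sub P Q hP hQ).const_mul (Real.exp (V / 2))
  calc klDiv (P.conv (stdGaussian (Vec d))) (Q.conv (stdGaussian (Vec d)))
      ≤ ∫⁻ y, ENNReal.ofReal (Real.exp (V / 2) * (convDensity P y - convDensity Q y) ^ 2)
          ∂(stdGaussian (Vec d)) := by
        rw [klDiv_conv_stdGaussian]
        refine lintegral_mono fun y => ENNReal.ofReal_le_ofReal ?_
        have hq := convDensity_pos Q y
        have hp := convDensity_pos P y
        have hl := exp_neg_le_convDensity Q hQ h0 y
        have h1 : 1 ≤ Real.exp (V / 2) * convDensity Q y := by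
          calc (1 : ℝ) = Real.exp (V / 2) * Real.exp (-V / 2) := by
                rw [← Real.exp_add, neg_div, add_neg_cancel, Real.exp_zero]
            _ ≤ _ := by gcongr
        calc convDensity Q y * klFun (convDensity P y / convDensity Q y)
            ≤ convDensity Q y * (convDensity P y / convDensity Q y - 1) ^ 2 := by
              gcongr
              exact klFun_le_sq (div_pos hp hq).le
          _ = (convDensity P y - convDensity Q y) ^ 2 / convDensity Q y := by
              field_simp
          _ ≤ Real.exp (V / 2) * (convDensity P y - convDensity Q y) ^ 2 := by
              rw [div_le_iff₀ hq]
              nlinarith [sq_nonneg (convDensity P y - convDensity Q y)]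
    _ = ENNReal.ofReal (Real.exp (V / 2) *
          ∫ y, (convDensity P y - convDensity Q y) ^ 2 ∂(stdGaussian (Vec d))) := by
        rw [← integral_const_mul, ofReal_integral_eq_lintegral_ofReal hi]
        exact .of_forall fun y => by positivity
    _ ≤ _ := by
        refine ENNReal.ofReal_le_ofReal ?_
        gcongr
        exact integral_sq_convDensity_sub_le P Q h hP hQ

end

end

/-! ### Centering, small scales, and the one-step bound at unit noise. -/

section

variable {d : ℕ}

theorem map_sub_const_conv (P ρ : Measure (Vec d)) [IsProbabilityMeasure P]
    [IsProbabilityMeasure ρ] (b : Vec d) :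
    (P.map (fun x => x - b)).conv ρ = (P.conv ρ).map (MeasurableEquiv.subRight b) := by
  refine Measure.ext_of_lintegral _ fun g hg => ?_
  have : IsProbabilityMeasure (P.map (fun x => x - b)) :=
    Measure.isProbabilityMeasure_map (by fun_prop)
  have hm : Measurable fun x => ∫⁻ y, g (x + y) ∂ρ :=
    Measurable.lintegral_prod_right (hg.comp (by fun_prop : Measurable fun p : Vec d × Vec d =>
      p.1 + p.2))
  rw [Measure.lintegral_conv hg, lintegral_map hm (by fun_prop),
    lintegral_map hg (MeasurableEquiv.measurable _), Measure.lintegral_conv]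
  · refine lintegral_congr fun x => lintegral_congr fun y => ?_
    congr 1
    rw [sub_add_eq_add_sub]
    rfl
  · exact hg.comp (MeasurableEquiv.measurable _)

theorem klDiv_conv_map_sub_const (P Q ρ : Measure (Vec d)) [IsProbabilityMeasure P]
    [IsProbabilityMeasure Q] [IsProbabilityMeasure ρ] (b : Vec d) :
    klDiv ((P.map (fun x => x - b)).conv ρ) ((Q.map (fun x => x - b)).conv ρ) =
      klDiv (P.conv ρ) (Q.conv ρ) := by
  rw [map_sub_const_conv, map_sub_const_conv, klDiv_map_measurableEquiv]

/-- By the binomial formula, a shifted moment of order `k` is a combination of moments of order at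
most `k`. -/
theorem SameMoments.map_sub_const {m : ℕ} {P Q : Measure (Vec d)} [IsProbabilityMeasure P]
    [IsProbabilityMeasure Q] (h : SameMoments m P Q)
    (hP : ∀ k, Integrable (fun x => ‖x‖ ^ k) P) (hQ : ∀ k, Integrable (fun x => ‖x‖ ^ k) Q)
    (b : Vec d) : SameMoments m (P.map (fun x => x - b)) (Q.map (fun x => x - b)) := by
  intro v k hk
  have key : ∀ ρ : Measure (Vec d), (∀ k, Integrable (fun x => ‖x‖ ^ k) ρ) →
      ∫ x, ⟪x, v⟫ ^ k ∂(ρ.map (fun x => x - b)) =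
        ∑ j ∈ range (k + 1), (∫ x, ⟪x, v⟫ ^ j ∂ρ) * (-⟪b, v⟫) ^ (k - j) * (k.choose j) := by
    intro ρ hρ
    rw [integral_map (by fun_prop) (Continuous.aestronglyMeasurable (by fun_prop))]
    simp_rw [inner_sub_left, sub_eq_add_neg, add_pow]
    rw [integral_finsetSum]
    · simp_rw [integral_mul_const]
    · intro j _
      refine Integrable.mul_const (Integrable.mul_const ?_ _) _
      refine ((hρ j).mul_const (‖v‖ ^ j)).mono' (Continuous.aestronglyMeasurable (by fun_prop))
        (.of_forall fun x => ?_)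
      rw [norm_pow, ← mul_pow]
      exact pow_le_pow_left₀ (norm_nonneg _) (norm_inner_le_norm _ _) j
  rw [key P hP, key Q hQ]
  refine sum_congr rfl fun j hj => ?_
  rw [h v j ((Nat.lt_succ_iff.1 (mem_range.1 hj)).trans hk)]

/-- Jensen for `u ↦ u ^ n`. It turns a product of weaker exponential moments into one linear
occurrence of the strong one. -/
theorem pow_integral_exp_le (P : Measure (Vec d)) [IsProbabilityMeasure P] {c : ℝ} (hc : 0 < c)
    (hP : Integrable (fun x => Real.exp (‖x‖ ^ 2 / c)) P) (n : ℕ) (hn : 1 ≤ n) :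
    (∫ x, Real.exp (‖x‖ ^ 2 / (n * c)) ∂P) ^ n ≤ ∫ x, Real.exp (‖x‖ ^ 2 / c) ∂P := by
  have hn' : (1 : ℝ) ≤ n := by exact_mod_cast hn
  have hpow : ∀ x : Vec d, Real.exp (‖x‖ ^ 2 / (n * c)) ^ n = Real.exp (‖x‖ ^ 2 / c) := by
    intro x
    rw [← Real.exp_nat_mul]
    congr 1
    field_simp
  have hi : Integrable (fun x => Real.exp (‖x‖ ^ 2 / (n * c))) P := by
    refine hP.mono' (Continuous.aestronglyMeasurable (by fun_prop)) (.of_forall fun x => ?_)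
    rw [Real.norm_of_nonneg (Real.exp_pos _).le]
    gcongr
    nlinarith
  simp_rw [← hpow]
  refine (convexOn_pow n).map_integral_le (continuous_pow n).continuousOn isClosed_Ici
    (.of_forall fun x => (Real.exp_pos _).le) hi ?_
  simpa only [Function.comp_def, hpow] using hP

/-- The constant in the small-noise bound of order `m`. -/
noncomputable def smallConst (m : ℕ) : ℝ := 1 + (m + 1).factorial * 32 ^ (m + 1)

theorem smallConst_pos (m : ℕ) : 0 < smallConst m := by unfold smallConst; positivity

theorem remainderWeight_sub_le (m : ℕ) {s : ℝ} (hs : 0 < s) (hs' : s ^ 2 ≤ 1 / 16) (x b : Vec d) :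
    remainderWeight m (x - b) ≤ smallConst m * s ^ (m + 1) * Real.exp (‖b‖ ^ 2 / (8 * s ^ 2)) *
      Real.exp (‖x‖ ^ 2 / (8 * s ^ 2)) := by
  set u := ‖x - b‖ / s with hu
  have hu0 : 0 ≤ u := by positivity
  have hxu : ‖x - b‖ = s * u := by rw [hu]; field_simp
  have h1 : u ^ 2 ≤ 2 * (‖x‖ ^ 2 + ‖b‖ ^ 2) / s ^ 2 := by
    rw [hu, div_pow]
    gcongr
    have := norm_sub_le x b
    nlinarith [sq_nonneg (‖x‖ - ‖b‖), norm_nonneg (x - b)]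
  -- The condition `s² ≤ 1/16` makes the second term at most `u² / 32`. The total `u² / 16`, with
  -- `‖x - b‖² ≤ 2 (‖x‖² + ‖b‖²)`, produces the denominator `8 s²`.
  have h2 : u ^ 2 / 32 + (s * u) ^ 2 / 2 ≤
      ‖b‖ ^ 2 / (8 * s ^ 2) + ‖x‖ ^ 2 / (8 * s ^ 2) := by
    calc u ^ 2 / 32 + (s * u) ^ 2 / 2 ≤ u ^ 2 / 16 := by nlinarith [sq_nonneg u]
      _ ≤ (2 * (‖x‖ ^ 2 + ‖b‖ ^ 2) / s ^ 2) / 16 := by gcongr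
      _ = _ := by field_simp; ring
  calc remainderWeight m (x - b) = s ^ (m + 1) * u ^ (m + 1) * Real.exp ((s * u) ^ 2 / 2) := by
        rw [remainderWeight, hxu, mul_pow]
    _ ≤ s ^ (m + 1) * (smallConst m * Real.exp (u ^ 2 / 32)) * Real.exp ((s * u) ^ 2 / 2) := by
        gcongr
        exact pow_le_mul_exp (m + 1) (by norm_num) hu0
    _ = smallConst m * s ^ (m + 1) * Real.exp (u ^ 2 / 32 + (s * u) ^ 2 / 2) := by
        rw [Real.exp_add]; ring
    _ ≤ smallConst m * s ^ (m + 1) *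
        Real.exp (‖b‖ ^ 2 / (8 * s ^ 2) + ‖x‖ ^ 2 / (8 * s ^ 2)) := by
        have := smallConst_pos m
        gcongr
    _ = _ := by rw [Real.exp_add]; ring

theorem klDiv_conv_stdGaussian_le_of_small {m : ℕ} {s : ℝ} (hs : 0 < s) (hs' : s ^ 2 ≤ 1 / 16)
    (P Q : Measure (Vec d)) [IsProbabilityMeasure P] [IsProbabilityMeasure Q]
    (h : SameMoments m P Q)
    (hP : Integrable (fun x => Real.exp (‖x‖ ^ 2 / s ^ 2)) P)
    (hQ : Integrable (fun x => Real.exp (‖x‖ ^ 2 / s ^ 2)) Q) :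
    klDiv (P.conv (stdGaussian (Vec d))) (Q.conv (stdGaussian (Vec d))) ≤
      ENNReal.ofReal (128 * smallConst m ^ 2 * s ^ (2 * (m + 1)) *
        (∫ x, Real.exp (‖x‖ ^ 2 / s ^ 2) ∂P + ∫ x, Real.exp (‖x‖ ^ 2 / s ^ 2) ∂Q)) := by
  have hs2 : 0 < s ^ 2 := by positivity
  -- Both measures are shifted by the mean of `Q`. The mean of `P` may differ when `m = 0`, but only
  -- the density of `Q` has to be bounded below.
  set b := ∫ x, x ∂Q with hb
  set V := ∫ x, ‖x‖ ^ 2 ∂Q with hV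
  set P' := P.map (fun x => x - b)
  set Q' := Q.map (fun x => x - b)
  have hP'p : IsProbabilityMeasure P' := Measure.isProbabilityMeasure_map (by fun_prop)
  have hQ'p : IsProbabilityMeasure Q' := Measure.isProbabilityMeasure_map (by fun_prop)
  have hexp : ∀ ρ : Measure (Vec d), Integrable (fun x => Real.exp (‖x‖ ^ 2 / s ^ 2)) ρ →
      Integrable (fun x => Real.exp (‖x‖ ^ 2)) (ρ.map (fun x => x - b)) := by
    intro ρ hρ
    rw [integrable_map_measure (Continuous.aestronglyMeasurable (by fun_prop)) (by fun_prop)]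
    refine (hρ.const_mul (Real.exp (2 * ‖b‖ ^ 2))).mono'
      (Continuous.aestronglyMeasurable (by fun_prop)) (.of_forall fun x => ?_)
    simp only [Function.comp_apply]
    rw [Real.norm_of_nonneg (Real.exp_pos _).le, ← Real.exp_add]
    gcongr
    have h1 : 2 * ‖x‖ ^ 2 ≤ ‖x‖ ^ 2 / s ^ 2 := by
      rw [le_div_iff₀ hs2]
      nlinarith [sq_nonneg ‖x‖]
    have := norm_sub_le x b
    nlinarith [sq_nonneg (‖x‖ - ‖b‖), norm_nonneg (x - b)]
  have hi8 : ∀ ρ : Measure (Vec d), Integrable (fun x => Real.exp (‖x‖ ^ 2 / s ^ 2)) ρ →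
      Integrable (fun x => Real.exp (‖x‖ ^ 2 / (8 * s ^ 2))) ρ := by
    intro ρ hρ
    refine hρ.mono' (Continuous.aestronglyMeasurable (by fun_prop)) (.of_forall fun x => ?_)
    rw [Real.norm_of_nonneg (Real.exp_pos _).le]
    gcongr
    linarith
  have hQ2 := integrable_norm_pow_of_exp hs2 hQ 2
  have hQ1 : Integrable (fun x : Vec d => x) Q := by
    have := integrable_norm_pow_of_exp hs2 hQ 1
    simp only [pow_one] at this
    exact (integrable_norm_iff (by fun_prop)).1 this
  set aP := ∫ x, Real.exp (‖x‖ ^ 2 / (8 * s ^ 2)) ∂P with haP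
  set aQ := ∫ x, Real.exp (‖x‖ ^ 2 / (8 * s ^ 2)) ∂Q with haQ
  have hone : ∀ ρ : Measure (Vec d), IsProbabilityMeasure ρ →
      Integrable (fun x => Real.exp (‖x‖ ^ 2 / s ^ 2)) ρ →
      1 ≤ ∫ x, Real.exp (‖x‖ ^ 2 / (8 * s ^ 2)) ∂ρ := by
    intro ρ _ hρ
    calc (1 : ℝ) = ∫ _, (1 : ℝ) ∂ρ := by simp
      _ ≤ _ := integral_mono (integrable_const _) (hi8 ρ hρ)
        fun x => Real.one_le_exp (by positivity)
  have haP1 : 1 ≤ aP := hone P inferInstance hP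
  have haQ1 : 1 ≤ aQ := hone Q inferInstance hQ
  have hVa : Real.exp (V / (8 * s ^ 2)) ≤ aQ := by
    rw [hV, ← integral_div]
    exact convexOn_exp.map_integral_le Real.continuous_exp.continuousOn isClosed_univ
      (.of_forall fun _ => Set.mem_univ _) (hQ2.div_const _) (hi8 Q hQ)
  have hV' : ∫ x, ‖x‖ ^ 2 ∂Q' = V - ‖b‖ ^ 2 := by
    rw [integral_map (by fun_prop) (Continuous.aestronglyMeasurable (by fun_prop))]
    simp_rw [norm_sub_sq_real]
    have i1 : Integrable (fun x : Vec d => 2 * ⟪x, b⟫) Q := (hQ1.inner_const b).const_mul 2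
    have i2 : Integrable (fun x : Vec d => ‖x‖ ^ 2 - 2 * ⟪x, b⟫) Q := hQ2.sub i1
    rw [integral_add i2 (integrable_const _), integral_sub hQ2 i1, integral_const_mul]
    simp_rw [real_inner_comm b]
    rw [integral_inner hQ1, ← hb, real_inner_self_eq_norm_sq]
    simp
    ring
  have hV0 : 0 ≤ ∫ x, ‖x‖ ^ 2 ∂Q' := integral_nonneg fun x => by positivity
  have hbV : ‖b‖ ^ 2 ≤ V := by rw [hV'] at hV0; linarith
  have hba : Real.exp (‖b‖ ^ 2 / (8 * s ^ 2)) ≤ aQ := le_trans (by gcongr) hVa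
  have hVexp : Real.exp ((∫ x, ‖x‖ ^ 2 ∂Q') / 2) ≤ aQ := by
    refine le_trans ?_ hVa
    gcongr
    · rw [hV']
      linarith [sq_nonneg ‖b‖]
    · linarith
  have hc0 : ∫ x, x ∂Q' = 0 := by
    rw [integral_map (by fun_prop) (Continuous.aestronglyMeasurable (by fun_prop)),
      integral_sub hQ1 (integrable_const _)]
    simp [hb]
  have hC := smallConst_pos m
  have hH : ∀ ρ : Measure (Vec d), Integrable (fun x => Real.exp (‖x‖ ^ 2 / s ^ 2)) ρ →
      ∫ x, remainderWeight m x ∂(ρ.map (fun x => x - b)) ≤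
        smallConst m * s ^ (m + 1) * aQ * ∫ x, Real.exp (‖x‖ ^ 2 / (8 * s ^ 2)) ∂ρ := by
    intro ρ hρ
    have hi := integrable_remainderWeight (hexp ρ hρ) m
    rw [integrable_map_measure (Continuous.aestronglyMeasurable
      (by unfold remainderWeight; fun_prop)) (by fun_prop)] at hi
    rw [integral_map (by fun_prop) (Continuous.aestronglyMeasurable
      (by unfold remainderWeight; fun_prop)), ← integral_const_mul]
    refine integral_mono hi ((hi8 ρ hρ).const_mul _) fun x => ?_
    refine (remainderWeight_sub_le m hs hs' x b).trans ?_
    gcongr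
  rw [← klDiv_conv_map_sub_const P Q (stdGaussian (Vec d)) b]
  refine (klDiv_conv_stdGaussian_le_of_centered P' Q' (h.map_sub_const
    (integrable_norm_pow_of_exp hs2 hP) (integrable_norm_pow_of_exp hs2 hQ) b)
    (hexp P hP) (hexp Q hQ) hc0).trans (ENNReal.ofReal_le_ofReal ?_)
  have hHP0 : 0 ≤ ∫ x, remainderWeight m x ∂P' :=
    integral_nonneg fun x => remainderWeight_nonneg m x
  have hHQ0 : 0 ≤ ∫ x, remainderWeight m x ∂Q' :=
    integral_nonneg fun x => remainderWeight_nonneg m x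
  have hpP := pow_integral_exp_le P hs2 hP 8 (by norm_num)
  have hpQ := pow_integral_exp_le Q hs2 hQ 8 (by norm_num)
  simp only [Nat.cast_ofNat] at hpP hpQ
  -- The product has total degree 5 in `aP` and `aQ`. Both are at least 1, so the degree can be
  -- raised to 8, where `pow_integral_exp_le` returns an expression linear in the exponential
  -- moments; the factor `2 ^ 7 = 128` comes from `add_pow_le`.
  calc Real.exp ((∫ x, ‖x‖ ^ 2 ∂Q') / 2) *
        (∫ x, remainderWeight m x ∂P' + ∫ x, remainderWeight m x ∂Q') ^ 2
      ≤ aQ * (smallConst m * s ^ (m + 1) * aQ * aP + smallConst m * s ^ (m + 1) * aQ * aQ) ^ 2 := by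
        gcongr
        · exact hH P hP
        · exact hH Q hQ
    _ = smallConst m ^ 2 * s ^ (2 * (m + 1)) * (aQ ^ 3 * (aP + aQ) ^ 2) := by ring
    _ ≤ smallConst m ^ 2 * s ^ (2 * (m + 1)) * ((aP + aQ) ^ 3 * (aP + aQ) ^ 2) := by
        gcongr
        linarith
    _ = smallConst m ^ 2 * s ^ (2 * (m + 1)) * (aP + aQ) ^ 5 := by ring
    _ ≤ smallConst m ^ 2 * s ^ (2 * (m + 1)) * (aP + aQ) ^ 8 := by
        gcongr
        · linarith
        · norm_num
    _ ≤ smallConst m ^ 2 * s ^ (2 * (m + 1)) * (2 ^ (8 - 1) * (aP ^ 8 + aQ ^ 8)) := by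
        gcongr
        exact add_pow_le (by linarith) (by linarith) 8
    _ ≤ smallConst m ^ 2 * s ^ (2 * (m + 1)) * (2 ^ (8 - 1) *
        (∫ x, Real.exp (‖x‖ ^ 2 / s ^ 2) ∂P + ∫ x, Real.exp (‖x‖ ^ 2 / s ^ 2) ∂Q)) := by
        gcongr
    _ = _ := by norm_num; ring

/-- The constant in the one-step bound of order `m`. -/
noncomputable def stepConst (m : ℕ) : ℝ := 128 * smallConst m ^ 2 + 16 ^ m

theorem stepConst_pos (m : ℕ) : 0 < stepConst m := by unfold stepConst; positivity

theorem klDiv_conv_stdGaussian_le {m : ℕ} {s : ℝ} (hs : 0 < s)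
    (P Q : Measure (Vec d)) [IsProbabilityMeasure P] [IsProbabilityMeasure Q]
    (h : SameMoments m P Q) :
    klDiv (P.conv (stdGaussian (Vec d))) (Q.conv (stdGaussian (Vec d))) ≤
      ENNReal.ofReal (stepConst m * s ^ (2 * (m + 1))) *
        (∫⁻ x, ENNReal.ofReal (Real.exp (‖x‖ ^ 2 / s ^ 2)) ∂P +
          ∫⁻ x, ENNReal.ofReal (Real.exp (‖x‖ ^ 2 / s ^ 2)) ∂Q) := by
  have hs2 : 0 < s ^ 2 := by positivity
  rcases le_total (s ^ 2) (1 / 16) with hs' | hs'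
  · have hne : ENNReal.ofReal (stepConst m * s ^ (2 * (m + 1))) ≠ 0 := by
      have := stepConst_pos m
      exact (ENNReal.ofReal_pos.2 (by positivity)).ne'
    -- An infinite exponential moment makes the bound trivial, since the prefactor is nonzero;
    -- otherwise integrability is available.
    by_cases htop : ∫⁻ x, ENNReal.ofReal (Real.exp (‖x‖ ^ 2 / s ^ 2)) ∂P +
          ∫⁻ x, ENNReal.ofReal (Real.exp (‖x‖ ^ 2 / s ^ 2)) ∂Q = ∞
    · rw [htop, ENNReal.mul_top hne]
      exact le_top
    rw [ENNReal.add_eq_top, not_or] at htop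
    have hi : ∀ ρ : Measure (Vec d),
        ∫⁻ x, ENNReal.ofReal (Real.exp (‖x‖ ^ 2 / s ^ 2)) ∂ρ ≠ ∞ →
        Integrable (fun x => Real.exp (‖x‖ ^ 2 / s ^ 2)) ρ := fun ρ hρ =>
      (lintegral_ofReal_ne_top_iff_integrable (Continuous.aestronglyMeasurable (by fun_prop))
        (.of_forall fun x => (Real.exp_pos _).le)).1 hρ
    have hP := hi P htop.1
    have hQ := hi Q htop.2
    refine (klDiv_conv_stdGaussian_le_of_small hs hs' P Q h hP hQ).trans ?_
    rw [← ofReal_integral_eq_lintegral_ofReal hP (.of_forall fun x => (Real.exp_pos _).le),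
      ← ofReal_integral_eq_lintegral_ofReal hQ (.of_forall fun x => (Real.exp_pos _).le),
      ← ENNReal.ofReal_add (integral_nonneg fun x => (Real.exp_pos _).le)
        (integral_nonneg fun x => (Real.exp_pos _).le),
      ← ENNReal.ofReal_mul (by have := stepConst_pos m; positivity)]
    refine ENNReal.ofReal_le_ofReal ?_
    have hP0 : 0 ≤ ∫ x, Real.exp (‖x‖ ^ 2 / s ^ 2) ∂P := integral_nonneg fun x => (Real.exp_pos _).le
    have hQ0 : 0 ≤ ∫ x, Real.exp (‖x‖ ^ 2 / s ^ 2) ∂Q := integral_nonneg fun x => (Real.exp_pos _).le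
    gcongr
    rw [stepConst]
    have : (0 : ℝ) ≤ 16 ^ m := by positivity
    linarith
  · have hsq : ∀ ρ : Measure (Vec d), ∫⁻ x, ENNReal.ofReal (‖x‖ ^ 2) ∂ρ ≤
        ENNReal.ofReal (stepConst m * s ^ (2 * (m + 1))) *
          ∫⁻ x, ENNReal.ofReal (Real.exp (‖x‖ ^ 2 / s ^ 2)) ∂ρ := by
      intro ρ
      rw [← lintegral_const_mul _ (by fun_prop)]
      refine lintegral_mono fun x => ?_
      rw [← ENNReal.ofReal_mul (by have := stepConst_pos m; positivity)]
      refine ENNReal.ofReal_le_ofReal ?_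
      have h1 : ‖x‖ ^ 2 ≤ s ^ 2 * Real.exp (‖x‖ ^ 2 / s ^ 2) := by
        have := Real.add_one_le_exp (‖x‖ ^ 2 / s ^ 2)
        calc ‖x‖ ^ 2 = s ^ 2 * (‖x‖ ^ 2 / s ^ 2) := by field_simp
          _ ≤ _ := by gcongr; linarith
      -- Here `16 s² ≥ 1`, so multiplying by its `m`-th power only increases `s²`; this is the
      -- source of `16 ^ m` in `stepConst`.
      have h2 : s ^ 2 ≤ stepConst m * s ^ (2 * (m + 1)) := by
        have h3 : 1 ≤ (16 * s ^ 2) ^ m := one_le_pow₀ (by linarith)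
        have h4 : (16 : ℝ) ^ m ≤ stepConst m := by
          rw [stepConst]; have := smallConst_pos m; nlinarith
        calc s ^ 2 ≤ (16 * s ^ 2) ^ m * s ^ 2 := le_mul_of_one_le_left hs2.le h3
          _ = 16 ^ m * s ^ (2 * (m + 1)) := by ring
          _ ≤ _ := by gcongr
      exact h1.trans (by gcongr)
    refine (klDiv_conv_stdGaussian_le_lintegral_sq P Q).trans ?_
    rw [mul_add]
    exact add_le_add (hsq P) (hsq Q)

end

/-! ### Rescaling and the kernel of one step. -/

section

variable {d : ℕ}

/-- The multinomial theorem writes `⟪x, v⟫ ^ k` as a combination of monomials of degree `k`. -/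
theorem sameMoments_of_monomials {m : ℕ} {P Q : Measure (Vec d)} {c : ℝ} (hc : 0 < c)
    (hP : Integrable (fun x => Real.exp (‖x‖ ^ 2 / c)) P)
    (hQ : Integrable (fun x => Real.exp (‖x‖ ^ 2 / c)) Q)
    (h : ∀ α : Fin d → ℕ, ∑ i, α i ≤ m →
      ∫ x, ∏ i, x i ^ α i ∂P = ∫ x, ∏ i, x i ^ α i ∂Q) : SameMoments m P Q := by
  intro v k hk
  have hexpand : ∀ x : Vec d, ⟪x, v⟫ ^ k = ∑ α ∈ piAntidiag univ k,
      ((Nat.multinomial univ α : ℝ) * ∏ i, v i ^ α i) * ∏ i, x i ^ α i := by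
    intro x
    have hin : ⟪x, v⟫ = ∑ i, v i * x i := by simp [PiLp.inner_apply]
    rw [hin, sum_pow_eq_sum_piAntidiag]
    refine sum_congr rfl fun α _ => ?_
    simp_rw [mul_pow, prod_mul_distrib, mul_assoc]
  have hint : ∀ ρ : Measure (Vec d), Integrable (fun x => Real.exp (‖x‖ ^ 2 / c)) ρ →
      ∀ α : Fin d → ℕ, Integrable (fun x : Vec d => ∏ i, x i ^ α i) ρ := by
    intro ρ hρ α
    refine (integrable_norm_pow_of_exp hc hρ (∑ i, α i)).mono'
      (Continuous.aestronglyMeasurable (by fun_prop)) (.of_forall fun x => ?_)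
    rw [norm_prod, ← prod_pow_eq_pow_sum]
    refine prod_le_prod (fun i _ => norm_nonneg _) fun i _ => ?_
    rw [norm_pow]
    exact pow_le_pow_left₀ (norm_nonneg _) (PiLp.norm_apply_le x i) _
  simp_rw [hexpand]
  rw [integral_finsetSum _ fun α _ => (hint P hP α).const_mul _,
    integral_finsetSum _ fun α _ => (hint Q hQ α).const_mul _]
  refine sum_congr rfl fun α hα => ?_
  rw [integral_const_mul, integral_const_mul, h α ((mem_piAntidiag.1 hα).1.trans_le hk)]

theorem SameMoments.map_const_smul {m : ℕ} {P Q : Measure (Vec d)} (h : SameMoments m P Q)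
    (a : ℝ) : SameMoments m (P.map (fun x => a • x)) (Q.map (fun x => a • x)) := by
  intro v k hk
  rw [integral_map (by fun_prop) (Continuous.aestronglyMeasurable (by fun_prop)),
    integral_map (by fun_prop) (Continuous.aestronglyMeasurable (by fun_prop))]
  simp_rw [real_inner_smul_left, ← real_inner_smul_right]
  exact h (a • v) k hk

theorem klDiv_conv_map_sqrt_smul_le {m : ℕ} {δ L : ℝ} (hδ : 0 < δ) (hL : 0 < L)
    (P Q : Measure (Vec d)) [IsProbabilityMeasure P] [IsProbabilityMeasure Q]
    (h : ∀ α : Fin d → ℕ, ∑ i, α i ≤ m →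
      ∫ x, ∏ i, x i ^ α i ∂P = ∫ x, ∏ i, x i ^ α i ∂Q) :
    klDiv ((P.map (fun x => √δ • x)).conv (stdGaussian (Vec d)))
        ((Q.map (fun x => √δ • x)).conv (stdGaussian (Vec d))) ≤
      ENNReal.ofReal (stepConst m * L ^ (2 * (m + 1)) * δ ^ (m + 1)) *
        (∫⁻ x, ENNReal.ofReal (Real.exp (‖x‖ ^ 2 / L ^ 2)) ∂P +
          ∫⁻ x, ENNReal.ofReal (Real.exp (‖x‖ ^ 2 / L ^ 2)) ∂Q) := by
  -- At scale `s = √δ L`, the exponential moment of `√δ X` is that of `X` at scale `L`.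
  have hs : 0 < √δ * L := mul_pos (Real.sqrt_pos.2 hδ) hL
  have hsδ : √δ ^ 2 = δ := Real.sq_sqrt hδ.le
  have hcst : stepConst m * L ^ (2 * (m + 1)) * δ ^ (m + 1) =
      stepConst m * (√δ * L) ^ (2 * (m + 1)) := by
    rw [mul_pow, pow_mul (√δ), hsδ]
    ring
  have hne : ENNReal.ofReal (stepConst m * L ^ (2 * (m + 1)) * δ ^ (m + 1)) ≠ 0 := by
    have := stepConst_pos m
    exact (ENNReal.ofReal_pos.2 (by positivity)).ne'
  by_cases htop : ∫⁻ x, ENNReal.ofReal (Real.exp (‖x‖ ^ 2 / L ^ 2)) ∂P +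
        ∫⁻ x, ENNReal.ofReal (Real.exp (‖x‖ ^ 2 / L ^ 2)) ∂Q = ∞
  · rw [htop, ENNReal.mul_top hne]
    exact le_top
  rw [ENNReal.add_eq_top, not_or] at htop
  have hi : ∀ ρ : Measure (Vec d),
      ∫⁻ x, ENNReal.ofReal (Real.exp (‖x‖ ^ 2 / L ^ 2)) ∂ρ ≠ ∞ →
      Integrable (fun x => Real.exp (‖x‖ ^ 2 / L ^ 2)) ρ := fun ρ hρ =>
    (lintegral_ofReal_ne_top_iff_integrable (Continuous.aestronglyMeasurable (by fun_prop))
      (.of_forall fun x => (Real.exp_pos _).le)).1 hρ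
  have hmom : SameMoments m P Q :=
    sameMoments_of_monomials (by positivity) (hi P htop.1) (hi Q htop.2) h
  have hmap : ∀ ρ : Measure (Vec d),
      ∫⁻ x, ENNReal.ofReal (Real.exp (‖x‖ ^ 2 / (√δ * L) ^ 2)) ∂(ρ.map (fun x => √δ • x)) =
        ∫⁻ x, ENNReal.ofReal (Real.exp (‖x‖ ^ 2 / L ^ 2)) ∂ρ := by
    intro ρ
    rw [lintegral_map (by fun_prop) (by fun_prop)]
    refine lintegral_congr fun x => ?_
    rw [norm_smul, mul_pow, mul_pow, Real.norm_eq_abs, sq_abs, hsδ,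
      mul_div_mul_left _ _ hδ.ne']
  have : IsProbabilityMeasure (P.map (fun x => √δ • x)) :=
    Measure.isProbabilityMeasure_map (by fun_prop)
  have : IsProbabilityMeasure (Q.map (fun x => √δ • x)) :=
    Measure.isProbabilityMeasure_map (by fun_prop)
  have hmain := klDiv_conv_stdGaussian_le hs _ _ (hmom.map_const_smul (√δ))
  rwa [hmap, hmap, ← hcst] at hmain

/-- One step of the sampler: `y ↦ Law(y + δ X̂ + √δ N)` with `X̂ ∼ κ(· ∣ y)`. -/
noncomputable def stepKernel (κ : Kernel (Vec d) (Vec d)) (δ : ℝ) : Kernel (Vec d) (Vec d) :=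
  ((Kernel.id ×ₖ κ) ×ₖ Kernel.const _ (stdGaussian (Vec d))).map
    (fun p : (Vec d × Vec d) × Vec d => p.1.1 + δ • p.1.2 + √δ • p.2)

instance (κ : Kernel (Vec d) (Vec d)) [IsMarkovKernel κ] (δ : ℝ) :
    IsMarkovKernel (stepKernel κ δ) := by
  unfold stepKernel
  exact Kernel.IsMarkovKernel.map _ (by fun_prop)

theorem lintegral_stepKernel (κ : Kernel (Vec d) (Vec d)) [IsMarkovKernel κ] (δ : ℝ) (y : Vec d)
    {g : Vec d → ℝ≥0∞} (hg : Measurable g) :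
    ∫⁻ z, g z ∂(stepKernel κ δ y) =
      ∫⁻ x, ∫⁻ n, g (y + δ • x + √δ • n) ∂(stdGaussian (Vec d)) ∂(κ y) := by
  have hm : Measurable fun p : (Vec d × Vec d) × Vec d => p.1.1 + δ • p.1.2 + √δ • p.2 := by
    fun_prop
  have hgm : Measurable fun p : (Vec d × Vec d) × Vec d =>
      g (p.1.1 + δ • p.1.2 + √δ • p.2) := hg.comp hm
  have hgm' : Measurable fun q : Vec d × Vec d =>
      ∫⁻ n, g (q.1 + δ • q.2 + √δ • n) ∂(stdGaussian (Vec d)) :=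
    hgm.lintegral_prod_right'
  rw [stepKernel, Kernel.map_apply _ hm, lintegral_map hg hm, Kernel.prod_apply,
    Kernel.prod_apply, Kernel.const_apply, lintegral_prod _ hgm.aemeasurable,
    lintegral_prod _ hgm'.aemeasurable, Kernel.id_apply, lintegral_dirac' _]
  exact hgm'.lintegral_prod_right'

/-- Factoring `y + δ x + √δ n = y + √δ (√δ x + n)` reduces a step to a convolution with unit noise.
-/
theorem stepKernel_apply_eq_map_conv (κ : Kernel (Vec d) (Vec d)) [IsMarkovKernel κ] {δ : ℝ}
    (hδ : 0 < δ) (y : Vec d) :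
    stepKernel κ δ y = (((κ y).map (fun x => √δ • x)).conv (stdGaussian (Vec d))).map
      (fun z => y + √δ • z) := by
  have : IsProbabilityMeasure ((κ y).map (fun x => √δ • x)) :=
    Measure.isProbabilityMeasure_map (by fun_prop)
  refine Measure.ext_of_lintegral _ fun g hg => ?_
  have hg' : Measurable fun z : Vec d => g (y + √δ • z) := hg.comp (by fun_prop)
  have hm : Measurable fun p : Vec d × Vec d => g (y + √δ • (p.1 + p.2)) :=
    hg.comp (by fun_prop)
  rw [lintegral_stepKernel κ δ y hg, lintegral_map hg (by fun_prop), Measure.lintegral_conv hg',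
    lintegral_map hm.lintegral_prod_right' (by fun_prop)]
  refine lintegral_congr fun x => lintegral_congr fun n => ?_
  rw [smul_add, smul_smul, Real.mul_self_sqrt hδ.le, add_assoc]

theorem stepKernel_absolutelyContinuous (κ η : Kernel (Vec d) (Vec d)) [IsMarkovKernel κ]
    [IsMarkovKernel η] {δ : ℝ} (hδ : 0 < δ) (y : Vec d) : stepKernel κ δ y ≪ stepKernel η δ y := by
  have : IsProbabilityMeasure ((κ y).map (fun x => √δ • x)) :=
    Measure.isProbabilityMeasure_map (by fun_prop)
  have : IsProbabilityMeasure ((η y).map (fun x => √δ • x)) :=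
    Measure.isProbabilityMeasure_map (by fun_prop)
  rw [stepKernel_apply_eq_map_conv κ hδ, stepKernel_apply_eq_map_conv η hδ]
  exact (conv_stdGaussian_absolutelyContinuous _ _).map (by fun_prop)

theorem klDiv_stepKernel_le {m : ℕ} {δ L : ℝ} (hδ : 0 < δ) (hL : 0 < L)
    (κ η : Kernel (Vec d) (Vec d)) [IsMarkovKernel κ] [IsMarkovKernel η] (y : Vec d)
    (h : ∀ α : Fin d → ℕ, ∑ i, α i ≤ m →
      ∫ x, ∏ i, x i ^ α i ∂(κ y) = ∫ x, ∏ i, x i ^ α i ∂(η y)) :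
    klDiv (stepKernel κ δ y) (stepKernel η δ y) ≤
      ENNReal.ofReal (stepConst m * L ^ (2 * (m + 1)) * δ ^ (m + 1)) *
        (∫⁻ x, ENNReal.ofReal (Real.exp (‖x‖ ^ 2 / L ^ 2)) ∂(κ y) +
          ∫⁻ x, ENNReal.ofReal (Real.exp (‖x‖ ^ 2 / L ^ 2)) ∂(η y)) := by
  have : IsProbabilityMeasure ((κ y).map (fun x => √δ • x)) :=
    Measure.isProbabilityMeasure_map (by fun_prop)
  have : IsProbabilityMeasure ((η y).map (fun x => √δ • x)) :=
    Measure.isProbabilityMeasure_map (by fun_prop)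
  rw [stepKernel_apply_eq_map_conv κ hδ, stepKernel_apply_eq_map_conv η hδ]
  exact (klDiv_map_le _ _ (by fun_prop)).trans (klDiv_conv_map_sqrt_smul_le hδ hL _ _ h)

end

/-! ### Independence and linear combinations of Gaussian noise. -/

section

theorem indepFun_prodMk_left_of_indepFun {Ω α β γ : Type*} [MeasurableSpace Ω]
    [MeasurableSpace α] [MeasurableSpace β] [MeasurableSpace γ] {P : Measure Ω}
    [IsProbabilityMeasure P] {X : Ω → α} {B : Ω → β} {W : Ω → γ} (hX : AEMeasurable X P)
    (hB : AEMeasurable B P) (hW : AEMeasurable W P)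
    (h1 : IndepFun X (fun ω => (B ω, W ω)) P) (h2 : IndepFun B W P) :
    IndepFun (fun ω => (X ω, B ω)) W P := by
  have : IsProbabilityMeasure (P.map X) := Measure.isProbabilityMeasure_map hX
  have : IsProbabilityMeasure (P.map B) := Measure.isProbabilityMeasure_map hB
  have : IsProbabilityMeasure (P.map W) := Measure.isProbabilityMeasure_map hW
  have h3 : IndepFun X B P := h1.comp (φ := id) (ψ := Prod.fst) measurable_id measurable_fst
  rw [indepFun_iff_map_prod_eq_prod_map_map (hX.prodMk hB) hW,
    (indepFun_iff_map_prod_eq_prod_map_map hX hB).1 h3]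
  have h4 := (indepFun_iff_map_prod_eq_prod_map_map hX (hB.prodMk hW)).1 h1
  rw [(indepFun_iff_map_prod_eq_prod_map_map hB hW).1 h2] at h4
  have h5 : P.map (fun ω => ((X ω, B ω), W ω)) =
      (P.map (fun ω => (X ω, (B ω, W ω)))).map MeasurableEquiv.prodAssoc.symm := by
    rw [AEMeasurable.map_map_of_aemeasurable (by fun_prop) (by fun_prop)]
    rfl
  rw [h5, h4]
  exact (Measure.prodAssoc_prod (τ := P.map W) (μ := P.map X) (ν := P.map B) ▸
    MeasurableEquiv.map_symm_map _)

/-- Extra conditioning on `W` carries no information about `X` when `W` is independent of the pair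
`(Y, X)`. -/
theorem HasCondDistrib.prodMk_right_of_indepFun {Ω α β γ : Type*} [MeasurableSpace Ω]
    [MeasurableSpace α] [MeasurableSpace β] [MeasurableSpace γ] {P : Measure Ω}
    [IsProbabilityMeasure P] {X : Ω → α} {Y : Ω → β} {W : Ω → γ} {κ : Kernel β α}
    [IsMarkovKernel κ] (h : HasCondDistrib X Y κ P) (hW : AEMeasurable W P)
    (hi : IndepFun (fun ω => (Y ω, X ω)) W P) :
    HasCondDistrib X (fun ω => (Y ω, W ω)) 
      (κ.comap (Prod.fst : β × γ → β) measurable_fst : Kernel (β × γ) α) P := by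
  have hY := h.aemeasurable_fst
  have hX := h.aemeasurable_snd
  have : IsProbabilityMeasure (P.map Y) := Measure.isProbabilityMeasure_map hY
  have : IsProbabilityMeasure (P.map W) := Measure.isProbabilityMeasure_map hW
  refine ⟨by fun_prop, ?_⟩
  have hYW : IndepFun Y W P := hi.comp (φ := Prod.fst) (ψ := id) measurable_fst measurable_id
  have h1 := (indepFun_iff_map_prod_eq_prod_map_map (hY.prodMk hX) hW).1 hi
  rw [h.map_eq] at h1
  rw [(indepFun_iff_map_prod_eq_prod_map_map hY hW).1 hYW]
  have h2 : P.map (fun ω => ((Y ω, W ω), X ω)) =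
      (P.map (fun ω => ((Y ω, X ω), W ω))).map
        (fun p : (β × α) × γ => ((p.1.1, p.2), p.1.2)) := by
    rw [AEMeasurable.map_map_of_aemeasurable (by fun_prop) (by fun_prop)]
    rfl
  rw [h2, h1]
  refine Measure.ext_of_lintegral _ fun g hg => ?_
  have hg1 : Measurable fun p : (β × α) × γ => g ((p.1.1, p.2), p.1.2) := hg.comp (by fun_prop)
  have hg2 : Measurable fun q : β × α => ∫⁻ w, g ((q.1, w), q.2) ∂(P.map W) :=
    hg1.lintegral_prod_right'
  rw [lintegral_map hg (by fun_prop), lintegral_prod _ hg1.aemeasurable,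
    Measure.lintegral_compProd hg2, Measure.lintegral_compProd hg,
    lintegral_prod _ (hg.lintegral_kernel_prod_right' ).aemeasurable]
  refine lintegral_congr fun y => ?_
  simp only [Kernel.comap_apply]
  exact lintegral_lintegral_swap
    (hg.comp (by fun_prop : Measurable fun p : α × γ => ((y, p.2), p.1))).aemeasurable

variable {d : ℕ} {Ω : Type*} [MeasurableSpace Ω] {P : Measure Ω} [IsProbabilityMeasure P]
  {ι : Type*} [Fintype ι] {N : ι → Ω → Vec d}

/-- Jointly Gaussian vectors are independent once uncorrelated, and orthogonal coefficients make
every covariance vanish. -/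
theorem indepFun_sum_smul_of_orthogonal {κ : Type*} [Fintype κ]
    (hN : ∀ i, HasLaw (N i) (stdGaussian (Vec d)) P) (hi : iIndepFun N P) (a : ι → ℝ)
    (b : κ → ι → ℝ) (hab : ∀ k, ∑ i, a i * b k i = 0) :
    IndepFun (fun ω => ∑ i, a i • N i ω) (fun ω k => ∑ i, b k i • N i ω) P := by
  have hG : ∀ i, HasGaussianLaw (N i) P := fun i => (hN i).hasGaussianLaw
  have hjoint : HasGaussianLaw (fun ω i => N i ω) P := iIndepFun.hasGaussianLaw hG hi
  let A : (ι → Vec d) →L[ℝ] Vec d × (κ → Vec d) :=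
    (∑ i, a i • ContinuousLinearMap.proj i).prod
      (ContinuousLinearMap.pi fun k => ∑ i, b k i • ContinuousLinearMap.proj i)
  have hA := hjoint.map_fun A
  have hAeq : (fun ω => A fun i => N i ω) =
      fun ω => (∑ i, a i • N i ω, fun k => ∑ i, b k i • N i ω) := by
    funext ω
    simp [A]
  rw [hAeq] at hA
  refine hA.indepFun_of_covariance_strongDual fun L₁ L₂ => ?_
  -- `ℓ i` is the action of `L₂` on the contribution of `N i`. Orthogonality becomes `∑ i, a i * ℓ i
  -- = 0`, so the covariance reduces to one with a constant.
  let ℓ : ι → StrongDual ℝ (Vec d) := fun i =>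
    L₂ ∘L ContinuousLinearMap.pi fun k => b k i • ContinuousLinearMap.id ℝ (Vec d)
  have hℓ : ∀ i v, ℓ i v = L₂ fun k => b k i • v := fun i v => rfl
  have e1 : (L₁ ∘ fun ω => ∑ i, a i • N i ω) = fun ω => ∑ i, a i * L₁ (N i ω) := by
    funext ω
    simp
  have e2 : (L₂ ∘ fun ω k => ∑ i, b k i • N i ω) = fun ω => ∑ i, ℓ i (N i ω) := by
    funext ω
    simp only [Function.comp_apply, hℓ, ← map_sum]
    congr 1
    funext k
    simp
  have m1 : ∀ (L : StrongDual ℝ (Vec d)) i, MemLp (fun ω => L (N i ω)) 2 P :=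
    fun L i => ((hG i).map_fun L).memLp_two
  rw [e1, e2, covariance_fun_sum_fun_sum (fun i => (m1 L₁ i).const_mul (a i)) fun i => m1 (ℓ i) i]
  classical
  have hcov : ∀ i j, cov[fun ω => a i * L₁ (N i ω), fun ω => ℓ j (N j ω); P] =
      if j = i then cov[fun x => L₁ x, fun x => a i * ℓ i x; stdGaussian (Vec d)] else 0 := by
    intro i j
    rw [covariance_const_mul_left]
    split_ifs with h
    · subst h
      rw [covariance_const_mul_right]
      congr 1
      exact (hN j).covariance_fun_comp (f := fun x => L₁ x) (g := fun x => ℓ j x) (by fun_prop)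
        (by fun_prop)
    · have := (hi.indepFun (Ne.symm h)).comp (φ := fun x => L₁ x) (ψ := fun x => ℓ j x)
        (by fun_prop) (by fun_prop)
      have h0 := this.covariance_eq_zero (m1 L₁ i) (m1 (ℓ j) j)
      rw [show cov[fun ω => L₁ (N i ω), fun ω => ℓ j (N j ω); P] = 0 from h0, mul_zero]
  have m2 : ∀ L : StrongDual ℝ (Vec d), MemLp (fun x => L x) 2 (stdGaussian (Vec d)) :=
    fun L => (IsGaussian.hasGaussianLaw_id.map_fun L).memLp_two
  simp_rw [hcov]
  simp only [sum_ite_eq', mem_univ, if_true]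
  rw [← covariance_fun_sum_right (fun i => (m2 (ℓ i)).const_mul (a i)) (m2 L₁)]
  have hz : (fun x : Vec d => ∑ i, a i * ℓ i x) = fun _ => 0 := by
    funext x
    simp only [hℓ, ← smul_eq_mul, ← map_smul, ← map_sum]
    convert map_zero L₂
    funext k
    simp only [Finset.sum_apply, Pi.smul_apply, smul_smul, ← sum_smul, hab k, zero_smul,
      Pi.zero_apply]
  rw [hz, covariance_const_right]

theorem hasLaw_sum_smul (hN : ∀ i, HasLaw (N i) (stdGaussian (Vec d)) P) (hi : iIndepFun N P)
    (a : ι → ℝ) {t : ℝ} (ht : ∑ i, a i ^ 2 = t) :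
    HasLaw (fun ω => ∑ i, a i • N i ω) ((stdGaussian (Vec d)).map (fun x => √t • x)) P := by
  have hm : ∀ i, AEMeasurable (N i) P := fun i => (hN i).aemeasurable
  have ht0 : 0 ≤ t := ht ▸ sum_nonneg fun i _ => sq_nonneg _
  have hsm : ∀ (c : ℝ) (x : Vec d), charFun ((stdGaussian (Vec d)).map (fun x => c • x)) x =
      Complex.exp (-(c ^ 2 * ‖x‖ ^ 2 : ℝ) / 2) := by
    intro c x
    rw [charFun_map_smul, charFun_stdGaussian, norm_smul, ← Complex.ofReal_pow, mul_pow,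
      Real.norm_eq_abs, sq_abs]
  have hlaw : ∀ i, P.map (fun ω => a i • N i ω) = (stdGaussian (Vec d)).map (fun x => a i • x) := by
    intro i
    rw [← (hN i).map_eq, AEMeasurable.map_map_of_aemeasurable (by fun_prop) (hm i)]
    rfl
  have hind : iIndepFun (fun i ω => a i • N i ω) P :=
    hi.comp (fun i x => a i • x) fun i => by fun_prop
  refine ⟨by fun_prop, ?_⟩
  have : IsProbabilityMeasure (P.map (fun ω => ∑ i, a i • N i ω)) :=
    Measure.isProbabilityMeasure_map (by fun_prop)
  have : IsProbabilityMeasure ((stdGaussian (Vec d)).map (fun x => √t • x)) :=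
    Measure.isProbabilityMeasure_map (by fun_prop)
  refine Measure.ext_of_charFun ?_
  rw [hind.charFun_map_fun_sum_eq_prod (fun i => by fun_prop)]
  funext x
  simp_rw [prod_apply, hlaw, hsm]
  rw [← Complex.exp_sum, Real.sq_sqrt ht0, ← ht]
  congr 1
  push_cast
  simp_rw [sum_mul, ← sum_div, sum_neg_distrib]

end

/-! ### The comparison process as an exact sampler. -/

section

theorem time_zero (δ : ℕ → ℝ) : time δ 0 = 0 := by simp [time]

theorem time_succ (δ : ℕ → ℝ) (k : ℕ) : time δ (k + 1) = time δ k + δ (k + 1) := by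
  rw [time, time, sum_Icc_succ_top (by omega)]

theorem time_eq_sum_fin (δ : ℕ → ℝ) {n k : ℕ} (hk : k ≤ n) :
    time δ k = ∑ j : Fin n, if (j : ℕ) < k then δ (j + 1) else 0 := by
  rw [Fin.sum_univ_eq_sum_range (fun j => if j < k then δ (j + 1) else 0) n]
  induction k with
  | zero => simp [time_zero]
  | succ k ih =>
    rw [time_succ, ih (by omega), ← sum_ite_eq_of_mem' (range n) k (fun j => δ (j + 1))
      (mem_range.2 (by omega)), ← sum_add_distrib]
    refine sum_congr rfl fun j _ => ?_
    rcases lt_trichotomy j k with h | h | h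
    · simp [h, h.ne, Nat.lt_succ_of_lt h]
    · simp [h]
    · simp [h.ne', show ¬ j < k by omega, show ¬ j < k + 1 by omega]

variable {d : ℕ}

/-- The coefficients of the accumulated noise at time `time δ k`. -/
noncomputable def noiseCoeff (δ : ℕ → ℝ) {n : ℕ} (k : ℕ) (j : Fin n) : ℝ :=
  if (j : ℕ) < k then √(δ (j + 1)) else 0

/-- This is the Brownian covariance `min (t_i, t_k)` of the accumulated noise. -/
theorem sum_noiseCoeff_mul {δ : ℕ → ℝ} {n : ℕ} (hδ : ∀ k ∈ Icc 1 n, 0 < δ k) {i k : ℕ}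
    (hik : i ≤ k) (hk : k ≤ n) :
    ∑ j : Fin n, noiseCoeff δ k j * noiseCoeff δ i j = time δ i := by
  rw [time_eq_sum_fin δ (hik.trans hk)]
  refine sum_congr rfl fun j _ => ?_
  have hj := hδ (j + 1) (mem_Icc.2 ⟨by omega, by omega⟩)
  unfold noiseCoeff
  split_ifs with h1 h2 h2
  · exact Real.mul_self_sqrt hj.le
  · simp
  · omega
  · simp

theorem time_nonneg {δ : ℕ → ℝ} {n : ℕ} (hδ : ∀ k ∈ Icc 1 n, 0 < δ k) {k : ℕ} (hk : k ≤ n) :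
    0 ≤ time δ k :=
  sum_nonneg fun i hi => (hδ i (mem_Icc.2 ⟨(mem_Icc.1 hi).1, (mem_Icc.1 hi).2.trans hk⟩)).le

theorem time_pos {δ : ℕ → ℝ} {n : ℕ} (hδ : ∀ k ∈ Icc 1 n, 0 < δ k) {k : ℕ} (hk : k ≤ n)
    (hk0 : 0 < k) : 0 < time δ k :=
  sum_pos (fun i hi => hδ i (mem_Icc.2 ⟨(mem_Icc.1 hi).1, (mem_Icc.1 hi).2.trans hk⟩))
    ⟨k, mem_Icc.2 ⟨hk0, le_rfl⟩⟩

/-- The accumulated noise at time `time δ k`. -/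
noncomputable def accNoise {Ω : Type*} (δ : ℕ → ℝ) (n : ℕ) (N : ℕ → Ω → Vec d) (k : ℕ) (ω : Ω) :
    Vec d := ∑ j : Fin n, noiseCoeff δ k j • N (j + 1) ω

instance (μ : Measure (Vec d)) [IsProbabilityMeasure μ] (t : ℝ) :
    IsMarkovKernel (posteriorKernel μ t) := by
  unfold posteriorKernel; infer_instance

instance (κ : Kernel (Vec d) (Vec d)) [IsMarkovKernel κ] (k : ℕ) :
    IsMarkovKernel (historyKernel κ k) := by
  unfold historyKernel; infer_instance

theorem measurable_obs (t : ℝ) : Measurable (obs (d := d) t) := by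
  unfold obs; fun_prop

instance (μ : Measure (Vec d)) [IsProbabilityMeasure μ] (t : ℝ) :
    IsProbabilityMeasure (obsLaw μ t) :=
  Measure.isProbabilityMeasure_map (measurable_obs t).aemeasurable

theorem obsLaw_compProd_posteriorKernel (μ : Measure (Vec d)) [IsProbabilityMeasure μ] (t : ℝ) :
    obsLaw μ t ⊗ₘ posteriorKernel μ t =
      (μ.prod (stdGaussian (Vec d))).map (fun p => (obs t p, p.1)) :=
  compProd_map_condDistrib measurable_fst.aemeasurable

namespace IsComparisonProcess

variable {Ω : Type*} [MeasurableSpace Ω] {P : Measure Ω} {n : ℕ} {δ : ℕ → ℝ}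
  {μ : Measure (Vec d)} {X : Ω → Vec d} {N Y : ℕ → Ω → Vec d}

theorem eq_smul_add_accNoise (h : IsComparisonProcess P n δ μ X N Y) {k : ℕ} (hk : k ≤ n)
    (ω : Ω) : Y k ω = time δ k • X ω + accNoise δ n N k ω := by
  induction k with
  | zero => simp [h.zero, time_zero, accNoise, noiseCoeff]
  | succ k ih =>
    have hacc : accNoise δ n N (k + 1) ω =
        accNoise δ n N k ω + √(δ (k + 1)) • N (k + 1) ω := by
      have hone : √(δ (k + 1)) • N (k + 1) ω =
          ∑ j : Fin n, if j = ⟨k, hk⟩ then √(δ (j + 1)) • N (j + 1) ω else 0 := by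
        rw [sum_ite_eq' univ (⟨k, hk⟩ : Fin n)]
        simp
      rw [hone, accNoise, accNoise, ← sum_add_distrib]
      refine sum_congr rfl fun j _ => ?_
      unfold noiseCoeff
      rcases lt_trichotomy (j : ℕ) k with h | h | h
      · simp [h, Fin.ext_iff, h.ne, Nat.lt_succ_of_lt h]
      · simp [h, Fin.ext_iff]
      · simp [Fin.ext_iff, h.ne', show ¬ (j : ℕ) < k by omega, show ¬ (j : ℕ) < k + 1 by omega]
    rw [h.step k (by omega), ih (by omega), hacc, time_succ, add_smul]
    abel

theorem aemeasurable_accNoise (h : IsComparisonProcess P n δ μ X N Y) (k : ℕ) :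
    AEMeasurable (accNoise δ n N k) P := by
  have : ∀ j : Fin n, AEMeasurable (N (j + 1)) P := fun j => (h.law_noise j j.2).aemeasurable
  unfold accNoise
  fun_prop

theorem indepFun_target (h : IsComparisonProcess P n δ μ X N Y) {β : Type*} [MeasurableSpace β]
    {f : (Fin n → Vec d) → β} (hf : Measurable f) :
    IndepFun X (fun ω => f fun j => N (j + 1) ω) P :=
  h.indep_target.comp (φ := id) measurable_id hf

variable [IsProbabilityMeasure P]

theorem hasLaw_accNoise (h : IsComparisonProcess P n δ μ X N Y)
    (hδ : ∀ k ∈ Icc 1 n, 0 < δ k) {k : ℕ} (hk : k ≤ n) :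
    HasLaw (accNoise δ n N k) ((stdGaussian (Vec d)).map (fun x => √(time δ k) • x)) P := by
  refine hasLaw_sum_smul (fun j : Fin n => h.law_noise j j.2) h.indep_noise _ ?_
  simp_rw [pow_two]
  exact sum_noiseCoeff_mul hδ le_rfl hk

theorem indepFun_path_noise (h : IsComparisonProcess P n δ μ X N Y) {k : ℕ} (hk : k < n) :
    IndepFun (fun ω => ((fun i : Fin (k + 1) => Y i ω), X ω)) (N (k + 1)) P := by
  have hN : ∀ j : Fin n, HasLaw (N (j + 1)) (stdGaussian (Vec d)) P := fun j => h.law_noise j j.2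
  have h1 : IndepFun (fun ω (i : Fin (k + 1)) => accNoise δ n N i ω) (N (k + 1)) P := by
    -- In the `Fin n` indexing `N (k + 1)` has index `k`, and accumulated noise up to time index `i
    -- ≤ k` uses only indices below `i`.
    have := indepFun_sum_smul_of_orthogonal (N := fun j : Fin n => N (j + 1)) hN h.indep_noise
      (fun j => if j = ⟨k, hk⟩ then 1 else 0)
      (fun i : Fin (k + 1) => fun j => noiseCoeff δ i j) (by
        intro i
        refine sum_eq_zero fun j _ => ?_
        by_cases hj : j = ⟨k, hk⟩
        · subst hj
          have : ¬ k < (i : ℕ) := by omega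
          simp [noiseCoeff, this]
        · simp [hj])
    have h2 := this.symm
    simp only [ite_smul, one_smul, zero_smul, sum_ite_eq', mem_univ, if_true] at h2
    exact h2
  have h2 : IndepFun X (fun ω => ((fun i : Fin (k + 1) => accNoise δ n N i ω), N (k + 1) ω)) P :=
    h.indepFun_target (f := fun z => ((fun i : Fin (k + 1) =>
      ∑ j : Fin n, noiseCoeff δ i j • z j), z ⟨k, hk⟩)) (by fun_prop)
  have hB := fun k => h.aemeasurable_accNoise k
  have h3 := indepFun_prodMk_left_of_indepFun h.law_target.aemeasurable
    (aemeasurable_pi_lambda _ fun i : Fin (k + 1) => hB i) (h.law_noise k hk).aemeasurable h2 h1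
  have h4 := h3.comp (φ := fun p : Vec d × (Fin (k + 1) → Vec d) =>
    ((fun i : Fin (k + 1) => time δ i • p.1 + p.2 i), p.1)) (ψ := id) (by fun_prop) measurable_id
  rw [Function.id_comp] at h4
  convert h4 using 1
  funext ω
  simp only [Function.comp_apply, Prod.mk.injEq, and_true]
  funext i
  exact h.eq_smul_add_accNoise (by omega) ω

theorem hasLaw_prodMk (h : IsComparisonProcess P n δ μ X N Y) [IsProbabilityMeasure μ]
    (hδ : ∀ k ∈ Icc 1 n, 0 < δ k) {k : ℕ} (hk : k ≤ n) :
    HasLaw (fun ω => (Y k ω, X ω))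
      ((μ.prod (stdGaussian (Vec d))).map (fun p => (obs (time δ k) p, p.1))) P := by
  have hX := h.law_target.aemeasurable
  have hB := h.aemeasurable_accNoise k
  have hi : IndepFun X (accNoise δ n N k) P :=
    h.indepFun_target (f := fun z => ∑ j : Fin n, noiseCoeff δ k j • z j) (by fun_prop)
  have h1 := (indepFun_iff_map_prod_eq_prod_map_map hX hB).1 hi
  have : IsProbabilityMeasure ((stdGaussian (Vec d)).map (fun x => √(time δ k) • x)) :=
    Measure.isProbabilityMeasure_map (by fun_prop)
  rw [h.law_target.map_eq, (h.hasLaw_accNoise hδ hk).map_eq,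
    show μ.prod ((stdGaussian (Vec d)).map (fun x => √(time δ k) • x)) =
      (μ.prod (stdGaussian (Vec d))).map (Prod.map id fun x => √(time δ k) • x) by
      rw [← Measure.map_prod_map _ _ measurable_id (by fun_prop), Measure.map_id]] at h1
  have hfun : (fun ω => (Y k ω, X ω)) = (fun p : Vec d × Vec d => (time δ k • p.1 + p.2, p.1)) ∘
      fun ω => (X ω, accNoise δ n N k ω) := by
    funext ω
    simp [h.eq_smul_add_accNoise hk ω]
  rw [hfun]
  refine ⟨(by fun_prop : Measurable fun p : Vec d × Vec d =>
    (time δ k • p.1 + p.2, p.1)).comp_aemeasurable (hX.prodMk hB), ?_⟩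
  rw [← AEMeasurable.map_map_of_aemeasurable (by fun_prop) (hX.prodMk hB), h1,
    Measure.map_map (by fun_prop) (by fun_prop)]
  rfl

theorem map_eq_obsLaw (h : IsComparisonProcess P n δ μ X N Y) [IsProbabilityMeasure μ]
    (hδ : ∀ k ∈ Icc 1 n, 0 < δ k) {k : ℕ} (hk : k ≤ n) : P.map (Y k) = obsLaw μ (time δ k) := by
  have h1 := h.hasLaw_prodMk hδ hk
  have h2 : P.map (Y k) = (P.map (fun ω => (Y k ω, X ω))).map Prod.fst := by
    rw [AEMeasurable.map_map_of_aemeasurable (by fun_prop) h1.aemeasurable]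
    rfl
  have hm := measurable_obs (d := d) (time δ k)
  rw [h2, h1.map_eq, Measure.map_map (by fun_prop) (hm.prodMk measurable_fst)]
  rfl

theorem hasCondDistrib_target (h : IsComparisonProcess P n δ μ X N Y) [IsProbabilityMeasure μ]
    (hδ : ∀ k ∈ Icc 1 n, 0 < δ k) {k : ℕ} (hk : k ≤ n) :
    HasCondDistrib X (Y k) (posteriorKernel μ (time δ k)) P := by
  have h1 := h.hasLaw_prodMk hδ hk
  refine ⟨h1.aemeasurable, ?_⟩
  rw [h1.map_eq, h.map_eq_obsLaw hδ hk, obsLaw_compProd_posteriorKernel]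

/-- Given the whole past, the law of `X` depends on the current value only. -/
theorem hasCondDistrib_path (h : IsComparisonProcess P n δ μ X N Y) [IsProbabilityMeasure μ]
    (hδ : ∀ k ∈ Icc 1 n, 0 < δ k) {k : ℕ} (hk : k ≤ n) :
    HasCondDistrib X (fun ω (i : Fin (k + 1)) => Y i ω)
      (historyKernel (posteriorKernel μ (time δ k)) k) P := by
  have hN : ∀ j : Fin n, HasLaw (N (j + 1)) (stdGaussian (Vec d)) P := fun j => h.law_noise j j.2
  -- Brownian bridge: with `B` the accumulated noise, `W i = B_i - (t_i / t_k) B_k` is orthogonal to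
  -- `B_k`. The drift cancels, so also `W i = Y_i - (t_i / t_k) Y_k`, and the past is a function of
  -- `(Y_k, W)` with `W` independent of `(Y_k, X)`. For `k = 0` the index type is empty and no
  -- division by zero occurs.
  let c : Fin k → ℝ := fun i => time δ i / time δ k
  have hc : ∀ i, c i * time δ k = time δ i := fun i =>
    div_mul_cancel₀ _ (time_pos hδ hk (by have := i.2; omega)).ne'
  let b : Fin k → Fin n → ℝ := fun i j => noiseCoeff δ i j - c i * noiseCoeff δ k j
  let W : Ω → Fin k → Vec d := fun ω i => ∑ j : Fin n, b i j • N (j + 1) ω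
  have hWeq : ∀ ω i, W ω i = accNoise δ n N i ω - c i • accNoise δ n N k ω := by
    intro ω i
    simp only [W, b, accNoise, sub_smul, sum_sub_distrib, smul_sum, mul_smul]
  have horth : ∀ i, ∑ j, noiseCoeff δ k j * b i j = 0 := by
    intro i
    simp only [b, mul_sub, sum_sub_distrib]
    rw [sum_noiseCoeff_mul hδ i.2.le hk]
    have : ∑ j : Fin n, noiseCoeff δ k j * (c i * noiseCoeff δ k j) = c i * time δ k := by
      rw [← sum_noiseCoeff_mul hδ le_rfl hk, mul_sum]
      exact sum_congr rfl fun j _ => by ring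
    rw [this, hc, sub_self]
  have h1 : IndepFun (accNoise δ n N k) W P :=
    indepFun_sum_smul_of_orthogonal (N := fun j : Fin n => N (j + 1)) hN h.indep_noise _ b horth
  have h2 : IndepFun X (fun ω => (accNoise δ n N k ω, W ω)) P :=
    h.indepFun_target (f := fun z => (∑ j : Fin n, noiseCoeff δ k j • z j,
      fun i : Fin k => ∑ j : Fin n, b i j • z j)) (by fun_prop)
  have hWm : AEMeasurable W P := by
    have := fun j => (hN j).aemeasurable
    refine aemeasurable_pi_lambda _ fun i => ?_
    fun_prop
  have h3 := indepFun_prodMk_left_of_indepFun h.law_target.aemeasurable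
    (h.aemeasurable_accNoise k) hWm h2 h1
  have h4 : IndepFun (fun ω => (Y k ω, X ω)) W P := by
    have := h3.comp (φ := fun p : Vec d × Vec d => (time δ k • p.1 + p.2, p.1)) (ψ := id)
      (by fun_prop) measurable_id
    rw [Function.id_comp] at this
    convert this using 1
    funext ω
    simp [h.eq_smul_add_accNoise hk ω]
  have h5 := HasCondDistrib.prodMk_right_of_indepFun (h.hasCondDistrib_target hδ hk) hWm h4
  -- `g` rebuilds the whole path from `(Y_k, W)`. Its last coordinate is `Y_k`, the only one the
  -- kernel reads, so conditioning passes to the path.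
  let g : Vec d × (Fin k → Vec d) → Fin (k + 1) → Vec d :=
    fun p => Fin.snoc (α := fun _ => Vec d) (fun i => p.2 i + c i • p.1) p.1
  have hg : Measurable g := by
    refine measurable_pi_lambda _ fun i => ?_
    induction i using Fin.lastCases with
    | last => simpa [g] using measurable_fst
    | cast i =>
      simp only [g, Fin.snoc_castSucc]
      fun_prop
  have hker : (posteriorKernel μ (time δ k)).comap
      (Prod.fst : Vec d × (Fin k → Vec d) → Vec d) measurable_fst =
      (historyKernel (posteriorKernel μ (time δ k)) k).comap g hg := by
    ext1 p
    simp [historyKernel, Kernel.comap_apply, g]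
  rw [hker] at h5
  have h6 := h5.comp_right
  convert h6 using 1
  funext ω i
  induction i using Fin.lastCases with
  | last => simp [g]
  | cast i =>
    simp only [g, Function.comp_apply, Fin.snoc_castSucc, Fin.val_castSucc, hWeq]
    rw [h.eq_smul_add_accNoise (by omega) ω, h.eq_smul_add_accNoise hk ω, smul_add, smul_smul, hc]
    abel

/-- The comparison process is the sampler that draws from the exact conditional laws. -/
theorem isSampler (h : IsComparisonProcess P n δ μ X N Y) [IsProbabilityMeasure μ]
    (hδ : ∀ k ∈ Icc 1 n, 0 < δ k) :
    IsSampler P n δ (posteriorKernel μ) (fun _ => X) N Y where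
  cond_law _ hk := h.hasCondDistrib_path hδ hk.le
  law_noise := h.law_noise
  indep_noise _ hk := h.indepFun_path_noise hk
  zero := h.zero
  step := h.step

end IsComparisonProcess

end

/-! ### Laws of histories, the chain rule, and the final bounds. -/

section

variable {d : ℕ}

/-- The joint law of the states at steps `0, …, k`. -/
noncomputable def historyLaw {Ω : Type*} [MeasurableSpace Ω] (P : Measure Ω)
    (Z : ℕ → Ω → Vec d) (k : ℕ) : Measure (Fin (k + 1) → Vec d) :=
  P.map (fun ω i => Z i ω)

theorem measurable_snoc (k : ℕ) : Measurable fun p : (Fin (k + 1) → Vec d) × Vec d =>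
    (Fin.snoc p.1 p.2 : Fin (k + 2) → Vec d) := by
  refine measurable_pi_lambda _ fun i => ?_
  induction i using Fin.lastCases with
  | last => simpa using measurable_snd
  | cast i =>
    simp only [Fin.snoc_castSucc]
    fun_prop

namespace IsSampler

variable {Ω : Type*} [MeasurableSpace Ω] {P : Measure Ω} {n : ℕ}
  {δ : ℕ → ℝ} {Q : ℝ → Kernel (Vec d) (Vec d)} {Xhat N Z : ℕ → Ω → Vec d}

/-- Measurability is not a field of `IsSampler`: the initial state is constant, and later states
inherit it from the conditional law and the noise of the preceding step. -/
theorem aemeasurable_history [∀ t, IsMarkovKernel (Q t)] (h : IsSampler P n δ Q Xhat N Z) {k : ℕ}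
    (hk : k ≤ n) : AEMeasurable (fun ω (i : Fin (k + 1)) => Z i ω) P := by
  rcases k with _ | k
  · have : (fun ω (i : Fin (0 + 1)) => Z i ω) = fun _ _ => 0 := by
      funext ω i
      rw [Fin.val_eq_zero i, h.zero]
    rw [this]
    fun_prop
  · have hc := h.cond_law k hk
    have hN := (h.law_noise k hk).aemeasurable
    have h1 := hc.aemeasurable_fst
    have h2 := hc.aemeasurable_snd
    have hl : AEMeasurable (fun ω => Z k ω) P := by
      have := (measurable_pi_apply (Fin.last k)).comp_aemeasurable h1
      exact this
    refine aemeasurable_pi_lambda _ fun i => ?_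
    induction i using Fin.lastCases with
    | last =>
      simp only [Fin.val_last, h.step k hk]
      fun_prop
    | cast i =>
      have := (measurable_pi_apply i).comp_aemeasurable h1
      exact this

theorem pathLaw_eq_map_historyLaw [∀ t, IsMarkovKernel (Q t)]
    (h : IsSampler P n δ Q Xhat N Z) :
    pathLaw P n Z = (historyLaw P Z n).map (fun z i => z i.succ) := by
  have hm : Measurable fun (z : Fin (n + 1) → Vec d) (i : Fin n) => z i.succ :=
    measurable_pi_lambda _ fun i => measurable_pi_apply i.succ
  rw [historyLaw, AEMeasurable.map_map_of_aemeasurable hm.aemeasurable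
    (h.aemeasurable_history le_rfl)]
  rfl

variable [IsProbabilityMeasure P]

/-- Integrating out the draw and the noise leaves a Markov transition. Laws of samplers on different
probability spaces thus become comparable through their step kernels. -/
theorem historyLaw_succ [∀ t, IsMarkovKernel (Q t)] (h : IsSampler P n δ Q Xhat N Z) {k : ℕ}
    (hk : k < n) :
    historyLaw P Z (k + 1) =
      (historyLaw P Z k ⊗ₘ historyKernel (stepKernel (Q (time δ k)) (δ (k + 1))) k).map
        (fun p => (Fin.snoc p.1 p.2 : Fin (k + 2) → Vec d)) := by
  have hc := h.cond_law k hk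
  have hN := h.law_noise k hk
  have hlaw := (indepFun_iff_map_prod_eq_prod_map_map hc.aemeasurable hN.aemeasurable).1
    (h.indep_noise k hk)
  rw [hc.map_eq, hN.map_eq] at hlaw
  have hZm : AEMeasurable (fun ω (i : Fin (k + 1)) => Z i ω) P := hc.aemeasurable_fst
  have : IsProbabilityMeasure (P.map fun ω (i : Fin (k + 1)) => Z i ω) :=
    Measure.isProbabilityMeasure_map hZm
  have : IsProbabilityMeasure (historyLaw P Z k) := this
  let φ : ((Fin (k + 1) → Vec d) × Vec d) × Vec d → Vec d := fun p =>
    p.1.1 (Fin.last k) + δ (k + 1) • p.1.2 + √(δ (k + 1)) • p.2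
  have hφ : Measurable φ := by
    simp only [φ]
    fun_prop
  have hψ : Measurable fun p : ((Fin (k + 1) → Vec d) × Vec d) × Vec d =>
      (Fin.snoc p.1.1 (φ p) : Fin (k + 2) → Vec d) :=
    (measurable_snoc k).comp ((measurable_fst.comp measurable_fst).prodMk hφ)
  have hfun : (fun ω (i : Fin (k + 2)) => Z i ω) =
      (fun p : ((Fin (k + 1) → Vec d) × Vec d) × Vec d =>
        (Fin.snoc p.1.1 (φ p) : Fin (k + 2) → Vec d)) ∘
      fun ω => (((fun i : Fin (k + 1) => Z i ω), Xhat (k + 1) ω), N (k + 1) ω) := by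
    funext ω i
    induction i using Fin.lastCases with
    | last => simp [φ, h.step k hk ω]
    | cast i => simp
  rw [historyLaw, hfun, ← AEMeasurable.map_map_of_aemeasurable hψ.aemeasurable
    (hc.aemeasurable.prodMk hN.aemeasurable), hlaw]
  refine Measure.ext_of_lintegral _ fun g hg => ?_
  have hgψ : Measurable fun p : ((Fin (k + 1) → Vec d) × Vec d) × Vec d =>
      g (Fin.snoc p.1.1 (φ p)) := hg.comp hψ
  have hgs : Measurable fun p : (Fin (k + 1) → Vec d) × Vec d =>
      g (Fin.snoc p.1 p.2) := hg.comp (measurable_snoc k)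
  have hgψ' : Measurable fun p : (Fin (k + 1) → Vec d) × Vec d =>
      ∫⁻ y, g (Fin.snoc p.1 (φ (p, y))) ∂(stdGaussian (Vec d)) := hgψ.lintegral_prod_right'
  rw [lintegral_map hg hψ, lintegral_prod _ hgψ.aemeasurable, lintegral_map hg (measurable_snoc k),
    Measure.lintegral_compProd hgs, historyLaw]
  refine (Measure.lintegral_compProd hgψ').trans (lintegral_congr fun w => ?_)
  have hgw : Measurable fun z : Vec d => g (Fin.snoc w z : Fin (k + 2) → Vec d) :=
    hgs.comp measurable_prodMk_left
  simp only [historyKernel, Kernel.comap_apply]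
  exact (lintegral_stepKernel (Q (time δ k)) (δ (k + 1)) (w (Fin.last k)) hgw).symm

theorem historyLaw_zero (h : IsSampler P n δ Q Xhat N Z) :
    historyLaw P Z 0 = Measure.dirac (fun _ => 0) := by
  have : (fun ω (i : Fin (0 + 1)) => Z i ω) = fun _ _ => 0 := by
    funext ω i
    rw [Fin.val_eq_zero i, h.zero]
  rw [historyLaw, this, Measure.map_const, measure_univ, one_smul]

end IsSampler

section

variable {Ω Ω' : Type*} [MeasurableSpace Ω] [MeasurableSpace Ω'] {P : Measure Ω} {P' : Measure Ω'}
  [IsProbabilityMeasure P] [IsProbabilityMeasure P'] {n : ℕ} {δ : ℕ → ℝ}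
  {Q Q' : ℝ → Kernel (Vec d) (Vec d)} [∀ t, IsMarkovKernel (Q t)] [∀ t, IsMarkovKernel (Q' t)]
  {Xhat N Z : ℕ → Ω → Vec d} {Xhat' N' Z' : ℕ → Ω' → Vec d}

/-- Chain rule for the divergence, after data processing removes the map that appends the new state.
The one-step term is averaged under the first process. -/
theorem klDiv_historyLaw_succ_le (h : IsSampler P n δ Q Xhat N Z)
    (h' : IsSampler P' n δ Q' Xhat' N' Z') {k : ℕ} (hk : k < n) (hδ : 0 < δ (k + 1)) :
    klDiv (historyLaw P Z (k + 1)) (historyLaw P' Z' (k + 1)) ≤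
      klDiv (historyLaw P Z k) (historyLaw P' Z' k) +
        ∫⁻ ω, klDiv (stepKernel (Q (time δ k)) (δ (k + 1)) (ω (Fin.last k)))
          (stepKernel (Q' (time δ k)) (δ (k + 1)) (ω (Fin.last k))) ∂(historyLaw P Z k) := by
  have : IsProbabilityMeasure (historyLaw P Z k) :=
    Measure.isProbabilityMeasure_map (h.aemeasurable_history hk.le)
  have : IsProbabilityMeasure (historyLaw P' Z' k) :=
    Measure.isProbabilityMeasure_map (h'.aemeasurable_history hk.le)
  rw [h.historyLaw_succ hk, h'.historyLaw_succ hk]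
  refine (klDiv_map_le _ _ (measurable_snoc k)).trans ?_
  rw [klDiv_compProd_eq_add, klDiv_compProd_right_eq_lintegral]
  · rfl
  · exact fun w => stepKernel_absolutelyContinuous _ _ hδ _

theorem klDiv_historyLaw_le_sum (h : IsSampler P n δ Q Xhat N Z)
    (h' : IsSampler P' n δ Q' Xhat' N' Z') (hδ : ∀ k ∈ Icc 1 n, 0 < δ k) {k : ℕ} (hk : k ≤ n) :
    klDiv (historyLaw P Z k) (historyLaw P' Z' k) ≤
      ∑ j ∈ range k, ∫⁻ ω, klDiv (stepKernel (Q (time δ j)) (δ (j + 1)) (ω (Fin.last j)))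
          (stepKernel (Q' (time δ j)) (δ (j + 1)) (ω (Fin.last j))) ∂(historyLaw P Z j) := by
  induction k with
  | zero => rw [h.historyLaw_zero, h'.historyLaw_zero, klDiv_self]; simp
  | succ k ih =>
    rw [sum_range_succ]
    refine (klDiv_historyLaw_succ_le h h' hk (hδ _ (mem_Icc.2 ⟨by omega, hk⟩))).trans ?_
    gcongr
    exact ih (by omega)

theorem pathDivergence_le_klDiv_historyLaw (h : IsSampler P n δ Q Xhat N Z)
    (h' : IsSampler P' n δ Q' Xhat' N' Z') :
    pathDivergence P P' n Z Z' ≤ klDiv (historyLaw P Z n) (historyLaw P' Z' n) := by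
  have : IsProbabilityMeasure (historyLaw P Z n) :=
    Measure.isProbabilityMeasure_map (h.aemeasurable_history le_rfl)
  have : IsProbabilityMeasure (historyLaw P' Z' n) :=
    Measure.isProbabilityMeasure_map (h'.aemeasurable_history le_rfl)
  rw [pathDivergence, h.pathLaw_eq_map_historyLaw, h'.pathLaw_eq_map_historyLaw]
  exact klDiv_map_le _ _ (measurable_pi_lambda _ fun i => measurable_pi_apply i.succ)

end

/-- Tower property: averaged over the observation, the posterior is the prior, so the tail bound for
`μ` controls the posterior on average. -/
theorem lintegral_posteriorKernel (μ : Measure (Vec d)) [IsProbabilityMeasure μ] (t : ℝ)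
    {g : Vec d → ℝ≥0∞} (hg : Measurable g) :
    ∫⁻ y, ∫⁻ x, g x ∂(posteriorKernel μ t y) ∂(obsLaw μ t) = ∫⁻ x, g x ∂μ := by
  have hgs : Measurable fun p : Vec d × Vec d => g p.2 := hg.comp measurable_snd
  have hgf : Measurable fun p : Vec d × Vec d => g p.1 := hg.comp measurable_fst
  rw [← Measure.lintegral_compProd hgs, obsLaw_compProd_posteriorKernel,
    lintegral_map hgs ((measurable_obs t).prodMk measurable_fst),
    lintegral_prod _ hgf.aemeasurable]
  simp

theorem pathDivergence_le {T L : ℝ} {m : ℕ} {μ : Measure (Vec d)} [IsProbabilityMeasure μ]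
    {Q : ℝ → Kernel (Vec d) (Vec d)} [∀ t, IsMarkovKernel (Q t)] (hM : MomentCondition T L m μ Q)
    {n : ℕ} {δ : ℕ → ℝ} (hδ : ∀ k ∈ Icc 1 n, 0 < δ k) (hT : ∀ k < n, time δ k ≤ T)
    {Ω : Type*} [MeasurableSpace Ω] {P : Measure Ω} [IsProbabilityMeasure P]
    {X : Ω → Vec d} {N Y : ℕ → Ω → Vec d} (hY : IsComparisonProcess P n δ μ X N Y)
    {Ω' : Type*} [MeasurableSpace Ω'] {P' : Measure Ω'} [IsProbabilityMeasure P']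
    {Xhat N' Z : ℕ → Ω' → Vec d} (hZ : IsSampler P' n δ Q Xhat N' Z) :
    pathDivergence P P' n Y Z ≤
      ENNReal.ofReal (4 * stepConst m * L ^ (2 * (m + 1)) * ∑ k ∈ Icc 1 n, δ k ^ (m + 1)) := by
  have hS := hY.isSampler hδ
  have hC := stepConst_pos m
  have hL := hM.L_pos
  refine (pathDivergence_le_klDiv_historyLaw hS hZ).trans
    ((klDiv_historyLaw_le_sum hS hZ hδ le_rfl).trans ?_)
  have hsum : ∑ k ∈ Icc 1 n, δ k ^ (m + 1) = ∑ j ∈ range n, δ (j + 1) ^ (m + 1) := by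
    rw [range_eq_Ico, sum_Ico_add' (fun k => δ k ^ (m + 1)) 0 n 1]
    rfl
  rw [hsum, mul_sum, ENNReal.ofReal_sum_of_nonneg]
  swap
  · intro j hj
    have := hδ (j + 1) (mem_Icc.2 ⟨by omega, by have := mem_range.1 hj; omega⟩)
    positivity
  refine sum_le_sum fun k hk => ?_
  have hk := mem_range.1 hk
  have hδk := hδ (k + 1) (mem_Icc.2 ⟨by omega, hk⟩)
  have ht : time δ k ∈ Set.Icc 0 T := ⟨time_nonneg hδ hk.le, hT k hk⟩
  set t := time δ k
  have hlast : Measurable fun w : Fin (k + 1) → Vec d => w (Fin.last k) := measurable_pi_apply _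
  have hmap : (historyLaw P Y k).map (fun w => w (Fin.last k)) = obsLaw μ t := by
    rw [historyLaw, AEMeasurable.map_map_of_aemeasurable hlast.aemeasurable
      (hS.aemeasurable_history hk.le), ← hY.map_eq_obsLaw hδ hk.le]
    rfl
  let e : Vec d → ℝ≥0∞ := fun x => ENNReal.ofReal (Real.exp (‖x‖ ^ 2 / L ^ 2))
  have he : Measurable e := by
    simp only [e]
    fun_prop
  let F : Vec d → ℝ≥0∞ := fun y =>
    ∫⁻ x, e x ∂(posteriorKernel μ t y) + ∫⁻ x, e x ∂(Q t y)
  have hF1 : Measurable fun y => ∫⁻ x, e x ∂(posteriorKernel μ t y) := he.lintegral_kernel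
  have hF2 : Measurable fun y => ∫⁻ x, e x ∂(Q t y) := he.lintegral_kernel
  have hF : Measurable F := hF1.add hF2
  have hFl : Measurable fun w : Fin (k + 1) → Vec d => F (w (Fin.last k)) := hF.comp hlast
  -- Moments match almost everywhere for the law of `Y(t)`, which is the last marginal of the
  -- history law of `Y`; the statement is pulled back along that projection.
  have hmom := hM.moments t ht
  rw [← hmap] at hmom
  calc ∫⁻ w, klDiv (stepKernel (posteriorKernel μ t) (δ (k + 1)) (w (Fin.last k)))
          (stepKernel (Q t) (δ (k + 1)) (w (Fin.last k))) ∂(historyLaw P Y k)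
      ≤ ∫⁻ w, ENNReal.ofReal (stepConst m * L ^ (2 * (m + 1)) * δ (k + 1) ^ (m + 1)) *
          F (w (Fin.last k)) ∂(historyLaw P Y k) := by
        refine lintegral_mono_ae ?_
        filter_upwards [ae_of_ae_map hlast.aemeasurable hmom] with w hw
        exact klDiv_stepKernel_le hδk hL _ _ _ hw
    _ = ENNReal.ofReal (stepConst m * L ^ (2 * (m + 1)) * δ (k + 1) ^ (m + 1)) *
          ∫⁻ y, F y ∂(obsLaw μ t) := by
        rw [lintegral_const_mul _ hFl, ← hmap, lintegral_map hF hlast]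
    _ ≤ ENNReal.ofReal (stepConst m * L ^ (2 * (m + 1)) * δ (k + 1) ^ (m + 1)) * (2 + 2) := by
        gcongr
        rw [lintegral_add_left hF1, lintegral_posteriorKernel μ t he]
        exact add_le_add hM.subGaussian_target (hM.subGaussian_kernel t ht)
    _ = ENNReal.ofReal (4 * stepConst m * L ^ (2 * (m + 1)) * δ (k + 1) ^ (m + 1)) := by
        rw [show (2 + 2 : ℝ≥0∞) = ENNReal.ofReal 4 by norm_num,
          ← ENNReal.ofReal_mul (by positivity)]
        congr 1
        ring

end

theorem time_le_of_uniform {T : ℝ} (hT : 0 < T) {n : ℕ} {δ : ℕ → ℝ}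
    (hδ : ∀ k ∈ Icc 1 n, δ k = T / n) {k : ℕ} (hk : k < n) : time δ k ≤ T := by
  have hn : (0 : ℝ) < n := by exact_mod_cast (Nat.zero_le k).trans_lt hk
  have hkn : (k : ℝ) ≤ n := by exact_mod_cast hk.le
  rw [time, sum_congr rfl fun i hi => hδ i
    (mem_Icc.2 ⟨(mem_Icc.1 hi).1, (mem_Icc.1 hi).2.trans hk.le⟩), sum_const, Nat.card_Icc,
    nsmul_eq_mul, Nat.add_sub_cancel, mul_div_assoc', div_le_iff₀ hn, mul_comm T]
  gcongr

theorem sum_pow_of_uniform (T : ℝ) (m : ℕ) {n : ℕ} (hn : 1 ≤ n) {δ : ℕ → ℝ}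
    (hδ : ∀ k ∈ Icc 1 n, δ k = T / n) :
    ∑ k ∈ Icc 1 n, δ k ^ (m + 1) = T ^ (m + 1) * (n : ℝ) ^ (-(m : ℤ)) := by
  have hn' : (n : ℝ) ≠ 0 := by exact_mod_cast (by omega : n ≠ 0)
  rw [sum_congr rfl fun k hk => by rw [hδ k hk], sum_const, Nat.card_Icc, nsmul_eq_mul,
    Nat.add_sub_cancel, zpow_neg, zpow_natCast]
  rw [div_pow, pow_succ (n : ℝ)]
  field_simp

end

theorem theorem3 (d m : ℕ) :
    (∃ c : ℝ, 0 < c ∧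
      ∀ (T L : ℝ) (μ : Measure (Vec d)) [IsProbabilityMeasure μ]
        (Q : ℝ → Kernel (Vec d) (Vec d)) [∀ t, IsMarkovKernel (Q t)],
        MomentCondition T L m μ Q →
        ∀ (n : ℕ) (δ : ℕ → ℝ), (∀ k ∈ Icc 1 n, 0 < δ k) → (∀ k < n, time δ k ≤ T) →
        ∀ (Ω : Type u) [MeasurableSpace Ω] (P : Measure Ω) [IsProbabilityMeasure P]
          (X : Ω → Vec d) (N Y : ℕ → Ω → Vec d),
          IsComparisonProcess P n δ μ X N Y →
        ∀ (Ω' : Type v) [MeasurableSpace Ω'] (P' : Measure Ω') [IsProbabilityMeasure P']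
          (Xhat N' Z : ℕ → Ω' → Vec d),
          IsSampler P' n δ Q Xhat N' Z →
        pathDivergence P P' n Y Z ≤
          ENNReal.ofReal (c * L ^ (2 * (m + 1)) * ∑ k ∈ Icc 1 n, δ k ^ (m + 1))) ∧
    (∀ T L : ℝ, 0 < T → 0 < L → ∃ c : ℝ, 0 < c ∧
      ∀ (μ : Measure (Vec d)) [IsProbabilityMeasure μ]
        (Q : ℝ → Kernel (Vec d) (Vec d)) [∀ t, IsMarkovKernel (Q t)],
        MomentCondition T L m μ Q →
        ∀ (n : ℕ) (δ : ℕ → ℝ), 1 ≤ n → (∀ k ∈ Icc 1 n, δ k = T / n) →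
        ∀ (Ω : Type u) [MeasurableSpace Ω] (P : Measure Ω) [IsProbabilityMeasure P]
          (X : Ω → Vec d) (N Y : ℕ → Ω → Vec d),
          IsComparisonProcess P n δ μ X N Y →
        ∀ (Ω' : Type v) [MeasurableSpace Ω'] (P' : Measure Ω') [IsProbabilityMeasure P']
          (Xhat N' Z : ℕ → Ω' → Vec d),
          IsSampler P' n δ Q Xhat N' Z →
        pathDivergence P P' n Y Z ≤ ENNReal.ofReal (c * (n : ℝ) ^ (-(m : ℤ)))) := by
  have hC := stepConst_pos m
  refine ⟨⟨4 * stepConst m, by positivity, ?_⟩, ?_⟩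
  · intro T L μ _ Q _ hM n δ hδ hT Ω _ P _ X N Y hY Ω' _ P' _ Xhat N' Z hZ
    exact pathDivergence_le hM hδ hT hY hZ
  · intro T L hT hL
    -- For uniform steps `∑ δ_k ^ (m + 1) = n (T / n) ^ (m + 1) = T ^ (m + 1) n ^ (-m)`.
    refine ⟨4 * stepConst m * L ^ (2 * (m + 1)) * T ^ (m + 1), by positivity, ?_⟩
    intro μ _ Q _ hM n δ hn hδ Ω _ P _ X N Y hY Ω' _ P' _ Xhat N' Z hZ
    have hn' : (0 : ℝ) < n := by exact_mod_cast hn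
    have hδ0 : ∀ k ∈ Icc 1 n, 0 < δ k := fun k hk => by
      rw [hδ k hk]
      positivity
    refine (pathDivergence_le hM hδ0 (fun k hk => time_le_of_uniform hT hδ hk) hY hZ).trans ?_
    rw [sum_pow_of_uniform T m hn hδ, mul_assoc _ (T ^ (m + 1))]
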